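/- **Notation.** For a finite set $\mathcal P\subset[0,1]^2$ of $r$ points with pairwise distinct x-coordinates and pairwise distinct y-coordinates, $\mathrm{perm}(\mathcal P)\in\mathfrak S_r$ denotes the permutation with $\mathrm{perm}(\mathcal P)(i)=j$ when the $i$-th point from the left is the $j$-th point from the bottom. For $\tau\in\mathfrak S_n$, $\pi\in\mathfrak S_r$, let $X_\pi(\tau)$ be the number of subsets $\{i_1<\dots<i_r\}\subseteq\{1,\dots,n\}$ such that, for all $j,k$, $\pi(j)<\pi(k)\Leftrightarrow\tau(i_j)<\tau(i_k)$. A cycle type of size $n$ is a sequence $t=(t_1,\dots,t_n)$ of nonnegative integers with $\sum_p p\,t_p=n$; a permutation of $\{1,\dots,n\}$ is $t$-cyclic if it has exactly $t_p$ cycles of length $p$ for every $p$. For $p_1\in[0,1]$ let $\hat Z_1,\dots,\hat Z_r$ be i.i.d. with law $p_1\mathrm{Leb}_\Delta+(1-p_1)\mathrm{Leb}_{[0,1]^2}$, where $\mathrm{Leb}_\Delta$ is the uniform probability measure on the diagonal of $[0,1]^2$, and set $$\psi_\pi^{p_1}(z)=\mathbb P\big(\mathrm{perm}(\hat Z_1,\dots,\hat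 Z_{r-1},z)=\pi\big)\quad(z\in[0,1]^2),\qquad \mu_\pi^{p_1}=\mathbb P\big(\mathrm{perm}(\hat Z_1,\dots,\hat Z_r)=\pi\big).$$ **Theorem.** Let $(t^{(n)})_n$ be a sequence of cycle types, $t^{(n)}$ of size $n$, such that $t_1^{(n)}=np_1+o(\sqrt n)$ and $2t_2^{(n)}=np_2+o(n)$ as $n\to\infty$, for some $p_1,p_2\in[0,1]$. For each $n$, let $\tau_n$ be a uniformly random $t^{(n)}$-cyclic permutation. Then for every integer $r\ge1$, we have the joint convergence in distribution $$\left(\frac{X_\pi(\tau_n)-\binom nr\mu_\pi^{p_1}}{n^{r-1/2}}\right)_{\pi\in\mathfrak S_r}\ \xrightarrow[n\to\infty]{}\ \mathcal N\big(0,\Sigma^{p_1,p_2}\big),$$ where $\Sigma^{p_1,p_2}$ is the positive semidefinite (possibly singular) matrix given, for $\pi,\rho\in\mathfrak S_r$ and $U,V,W$ i.i.d. uniform on $[0,1]$, by $$\begin{aligned}(r-1)!^2\,\Sigma^{p_1,p_2}_{\pi,\rho}={}&p_1\mathrm{Cov}\big(\psi_\pi^{p_1}(U,U),\psi_\rho^{p_1}(U,U)\big)+(1-p_1)\mathrm{Cov}\big(\psi_\pi^{p_1}(U,V),\psi_\rho^{p_1}(U,V)\big)\\&+p_2\mathrm{Cov}\big(\psi_\pi^{p_1}(U,V),\psi_\rho^{p_1}(V,U)\big)\\&+(1-p_1-p_2)\Big(\mathrm{Cov}\big(\psi_\pi^{p_1}(U,V),\psi_\rho^{p_1}(V,W)\big)+\mathrm{Cov}\big(\psi_\rho^{p_1}(U,V),\psi_\pi^{p_1}(V,W)\big)\Big).\end{aligned}$$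 -/

import Mathlib

open MeasureTheory ProbabilityTheory Filter Asymptotics
open scoped unitInterval Nat

namespace PermPattern

/-- The standardization of a finite sequence of pairwise distinct elements of a linear order:
the permutation which is ordered in the same way as the sequence
(see `standardize_lt_standardize_iff`). Ties are broken by the index. -/
def standardize {n : ℕ} {α : Type*} [LinearOrder α] (y : Fin n → α) : Equiv.Perm (Fin n) :=
  (Tuple.sort y)⁻¹

theorem standardize_lt_standardize_iff {n : ℕ} {α : Type*} [LinearOrder α] {y : Fin n → α}
    (hy : Function.Injective y) (i j : Fin n) :
    standardize y i < standardize y j ↔ y i < y j := by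
  have hm : StrictMono (y ∘ Tuple.sort y) :=
    (Tuple.monotone_sort y).strictMono_of_injective (hy.comp (Tuple.sort y).injective)
  have h := hm.lt_iff_lt (a := standardize y i) (b := standardize y j)
  simpa [standardize] using h.symm

/-- The permutation of a family of points of the unit square having pairwise distinct
x-coordinates and pairwise distinct y-coordinates: the points are listed from left to right and
the sequence of their heights is standardized. -/
noncomputable def permOfPoints {r : ℕ} (z : Fin r → I × I) : Equiv.Perm (Fin r) :=
  standardize fun i => (z (Tuple.sort (fun k => (z k).1) i)).2

/-- The pattern induced by the permutation `τ` on the set `s` of `r` positions. -/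
def pat {n r : ℕ} (s : {s : Finset (Fin n) // s.card = r}) (τ : Equiv.Perm (Fin n)) :
    Equiv.Perm (Fin r) :=
  standardize fun j => τ (s.1.orderEmbOfFin s.2 j)

/-- The number of occurrences of the pattern `π` in the permutation `τ`. -/
def patternCount {n r : ℕ} (π : Equiv.Perm (Fin r)) (τ : Equiv.Perm (Fin n)) : ℕ :=
  Fintype.card {s : {s : Finset (Fin n) // s.card = r} // pat s τ = π}

/-- Every set of permutations of `Fin n` is measurable. -/
instance measurableSpacePerm (n : ℕ) : MeasurableSpace (Equiv.Perm (Fin n)) := ⊤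

instance discreteMeasurableSpacePerm (n : ℕ) : DiscreteMeasurableSpace (Equiv.Perm (Fin n)) :=
  ⟨fun _ => trivial⟩

/-- The number of `p`-cycles (fixed points, for `p = 1`) of a permutation with cycle type `t`.
A cycle type of size `n` is encoded as the partition of `n` made of the cycle lengths. -/
def numCycles {n : ℕ} (t : n.Partition) (p : ℕ) : ℕ := t.parts.count p

/-- The conjugacy class of all permutations of `Fin n` with cycle type `t`
(fixed points being counted as cycles of length one). -/
def cyclicClass {n : ℕ} (t : n.Partition) : Set (Equiv.Perm (Fin n)) :=
  {g | g.partition.parts = t.parts}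

/-- The law `p • Leb_Δ + (1 - p) • Leb_{[0,1]²}` on the unit square, where `Leb_Δ` is the uniform
probability measure on the diagonal. -/
noncomputable def pointLaw (p : ℝ) : Measure (I × I) :=
  ENNReal.ofReal p • (volume : Measure I).map (fun u => (u, u)) +
    ENNReal.ofReal (1 - p) • (volume : Measure (I × I))

/-- `ψ_π^p(z)`, the probability that `r - 1` independent points with law `pointLaw p` together
with the point `z` form the permutation `π`. -/
noncomputable def psi {r : ℕ} (p : ℝ) (π : Equiv.Perm (Fin r)) (z : I × I) : ℝ :=
  (Measure.pi fun _ : Fin (r - 1) => pointLaw p).real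
    {Z | permOfPoints (fun i : Fin r => if h : i.val < r - 1 then Z ⟨i.val, h⟩ else z) = π}

/-- `μ_π^p`, the probability that `r` independent points with law `pointLaw p` form the
permutation `π`. -/
noncomputable def patternMean {r : ℕ} (p : ℝ) (π : Equiv.Perm (Fin r)) : ℝ :=
  (Measure.pi fun _ : Fin r => pointLaw p).real {Z | permOfPoints Z = π}

/-- The asymptotic covariance matrix. The coordinates `ω.1`, `ω.2.1`, `ω.2.2` of the unit cube are
three independent uniform variables `U`, `V`, `W`. -/
noncomputable def limitCov (r : ℕ) (p₁ p₂ : ℝ) :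
    Matrix (Equiv.Perm (Fin r)) (Equiv.Perm (Fin r)) ℝ :=
  Matrix.of fun π ρ =>
    (p₁ * cov[fun ω : I × I × I => psi p₁ π (ω.1, ω.1),
          fun ω => psi p₁ ρ (ω.1, ω.1); volume]
      + (1 - p₁) * cov[fun ω : I × I × I => psi p₁ π (ω.1, ω.2.1),
          fun ω => psi p₁ ρ (ω.1, ω.2.1); volume]
      + p₂ * cov[fun ω : I × I × I => psi p₁ π (ω.1, ω.2.1),
          fun ω => psi p₁ ρ (ω.2.1, ω.1); volume]
      + (1 - p₁ - p₂) *
        (cov[fun ω : I × I × I => psi p₁ π (ω.1, ω.2.1),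
            fun ω => psi p₁ ρ (ω.2.1, ω.2.2); volume]
          + cov[fun ω : I × I × I => psi p₁ ρ (ω.1, ω.2.1),
            fun ω => psi p₁ π (ω.2.1, ω.2.2); volume])) / ((r - 1)! : ℝ) ^ 2

end PermPattern

/-!
A uniform element of a conjugacy class keeps its law when it is conjugated, so `τ_n` may be replaced
by `η ρ η⁻¹`, where `ρ` is any fixed element of the class and `η` is the standardization of i.i.d.
uniform variables `u_i`. This conjugate is ordered like the points `(u_i, u_{ρ i})`, and its pattern
counts become sums over tuples of such points, which are independent as soon as their indices are
distinct and not neighbours in the cycles of `ρ`.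

The first-order Hoeffding projection turns a linear combination of pattern counts into
`∑ i, f (u_i, u_{ρ i})` up to an error negligible in `L²`. Each summand is independent of all but
its neighbours along the cycles, so the characteristic function of the sum approximately satisfies
the differential equation of a Gaussian one (the Stein–Tikhomirov method). Its variance is affine in
the proportions of points of `ρ` lying in cycles of length one and two, which gives the limiting
covariance and its positivity. Lévy's continuity theorem and the Cramér–Wold device conclude.
-/

namespace PermPattern

section Sorting

variable {n : ℕ} {α β γ : Type*} [LinearOrder α] [LinearOrder β]

theorem strictMono_comp_sort {y : Fin n → α} (hy : Function.Injective y) :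
    StrictMono (y ∘ Tuple.sort y) :=
  (Tuple.monotone_sort y).strictMono_of_injective (hy.comp (Tuple.sort y).injective)

theorem sort_eq_of_strictMono {y : Fin n → α} {η : Equiv.Perm (Fin n)} (h : StrictMono (y ∘ η)) :
    Tuple.sort y = η :=
  (Tuple.eq_sort_iff.2 ⟨h.monotone, fun _ _ hij he => absurd he (h hij).ne⟩).symm

theorem sort_comp_perm {y : Fin n → α} (hy : Function.Injective y) (η : Equiv.Perm (Fin n)) :
    Tuple.sort (y ∘ η) = η⁻¹ * Tuple.sort y := by
  refine sort_eq_of_strictMono ?_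
  convert strictMono_comp_sort hy using 1
  ext i
  simp

theorem sort_congr {y : Fin n → α} {y' : Fin n → β} (h : ∀ i j, y i ≤ y j ↔ y' i ≤ y' j) :
    Tuple.sort y = Tuple.sort y' := by
  obtain ⟨hmono, hties⟩ := Tuple.eq_sort_iff.1 (rfl : Tuple.sort y = Tuple.sort y)
  exact Tuple.eq_sort_iff.2 ⟨fun i j hij => (h _ _).1 (hmono hij), fun i j hij he =>
    hties i j hij (le_antisymm ((h _ _).2 he.le) ((h _ _).2 he.ge))⟩

theorem standardize_congr {y : Fin n → α} {y' : Fin n → β} (h : ∀ i j, y i ≤ y j ↔ y' i ≤ y' j) :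
    standardize y = standardize y' :=
  congrArg (·⁻¹) (sort_congr h)

theorem standardize_le_standardize_iff {y : Fin n → α} (hy : Function.Injective y) (i j : Fin n) :
    standardize y i ≤ standardize y j ↔ y i ≤ y j := by
  simpa only [not_lt] using (standardize_lt_standardize_iff hy j i).not

theorem comp_sort_eq_orderEmbOfFin (k : Fin n ↪ α) (h : (Finset.univ.map k).card = n) :
    k ∘ Tuple.sort k = (Finset.univ.map k).orderEmbOfFin h :=
  Finset.orderEmbOfFin_unique h (fun i => by simp) (strictMono_comp_sort k.injective)

variable [TopologicalSpace α] [OrderClosedTopology α] [SecondCountableTopology α]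
  [MeasurableSpace α] [OpensMeasurableSpace α]

theorem measurable_of_le_iff_le_congr {ι : Type*} [Finite ι]
    [MeasurableSpace γ] [Nonempty γ] {f : (ι → α) → γ}
    (hf : ∀ y y', (∀ i j, y i ≤ y j ↔ y' i ≤ y' j) → f y = f y') : Measurable f := by
  let comparisons (y : ι → α) (i j : ι) : Prop := y i ≤ y j
  have hfac : f.FactorsThrough comparisons := fun y y' h => hf y y' fun i j =>
    iff_of_eq (congrFun₂ h i j)
  rw [← hfac.extend_comp fun _ => Classical.arbitrary γ]
  refine (measurable_of_countable _).comp (measurable_pi_lambda _ fun i =>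
    measurable_pi_lambda _ fun j => measurableSet_setOfPred.1 ?_)
  exact measurableSet_le (measurable_pi_apply i) (measurable_pi_apply j)

theorem measurable_sort : Measurable (Tuple.sort : (Fin n → α) → Equiv.Perm (Fin n)) :=
  measurable_of_le_iff_le_congr fun _ _ => sort_congr

theorem measurable_standardize :
    Measurable (standardize : (Fin n → α) → Equiv.Perm (Fin n)) :=
  measurable_of_le_iff_le_congr fun _ _ => standardize_congr

end Sorting

section PatternsOfPoints

variable {n r : ℕ}

theorem permOfPoints_comp_perm {z : Fin r → I × I} (hz : Function.Injective fun k => (z k).1)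
    (η : Equiv.Perm (Fin r)) : permOfPoints (z ∘ η) = permOfPoints z := by
  have hsort : Tuple.sort (fun k => (z (η k)).1) = η⁻¹ * Tuple.sort fun k => (z k).1 :=
    sort_comp_perm hz η
  simp [permOfPoints, hsort]

theorem measurable_permOfPoints : Measurable (permOfPoints : (Fin r → I × I) → _) := by
  have hheights (η : Equiv.Perm (Fin r)) :
      Measurable fun z : Fin r → I × I => standardize fun i => (z (η i)).2 :=
    measurable_standardize.comp (by fun_prop)
  have habscissae : Measurable fun z : Fin r → I × I => Tuple.sort fun k => (z k).1 :=
    measurable_sort.comp (by fun_prop)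
  unfold permOfPoints
  have huncurry : Measurable (Function.uncurry fun (η : Equiv.Perm (Fin r)) (z : Fin r → I × I) =>
      standardize fun i => (z (η i)).2) := measurable_from_prod_countable_right hheights
  simpa only [Function.comp_def, Function.uncurry_apply_pair, id_eq] using
    huncurry.comp (habscissae.prodMk measurable_id)

/-- The `i`-th point of the graph of the permutation `ρ` of the labels, drawn in the plane by
placing the label `j` at the coordinate `u j` on both axes. -/
def graphPoint {ι α : Type*} (ρ : Equiv.Perm ι) (u : ι → α) (i : ι) : α × α := (u i, u (ρ i))

theorem permOfPoints_graphPoint {u : Fin n → I} (hu : Function.Injective u)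
    (ρ : Equiv.Perm (Fin n)) (k : Fin r ↪ Fin n)
    (h : (Finset.univ.map (k.trans (standardize u).toEmbedding)).card = r) :
    permOfPoints (fun a => graphPoint ρ u (k a)) =
      pat ⟨Finset.univ.map (k.trans (standardize u).toEmbedding), h⟩
        (standardize u * ρ * (standardize u)⁻¹) := by
  set η := standardize u with hη
  have hsort : Tuple.sort (fun a => u (k a)) = Tuple.sort (k.trans η.toEmbedding) :=
    sort_congr fun i j => (standardize_le_standardize_iff hu _ _).symm
  simp only [permOfPoints, pat, graphPoint, hsort, ← comp_sort_eq_orderEmbOfFin]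
  refine standardize_congr fun i j => ?_
  simp [hη, standardize_le_standardize_iff hu]

theorem card_filter_map_eq {ι α : Type*} [Fintype ι] [Fintype α]
    [DecidableEq α] {s : Finset α} (hs : s.card = Fintype.card ι) :
    (Finset.univ.filter fun k : ι ↪ α => Finset.univ.map k = s).card = (Fintype.card ι)! := by
  classical
  have hcard : Fintype.card ι = Fintype.card s := by rw [Fintype.card_coe, hs]
  let enumerations : (ι ≃ s) ↪ (ι ↪ α) :=
    ⟨fun e => e.toEmbedding.trans (Function.Embedding.subtype _), fun e e' h =>
      Equiv.ext fun i => Subtype.ext (DFunLike.congr_fun h i)⟩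
  have hfiber : (Finset.univ.filter fun k : ι ↪ α => Finset.univ.map k = s) =
      Finset.univ.map enumerations := by
    ext k
    simp only [Finset.mem_filter, Finset.mem_univ, true_and, Finset.mem_map]
    constructor
    · rintro rfl
      exact ⟨Equiv.ofBijective (fun i => ⟨k i, by simp⟩)
        ⟨fun i j h => k.injective (congrArg Subtype.val h), fun ⟨x, hx⟩ => by
          simpa [Subtype.ext_iff] using hx⟩, rfl⟩
    · rintro ⟨e, rfl⟩
      ext x
      simp only [Finset.mem_map, Finset.mem_univ, true_and]
      exact ⟨fun ⟨i, hi⟩ => hi ▸ (e i).2, fun hx =>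
        ⟨e.symm ⟨x, hx⟩, congrArg Subtype.val (e.apply_symm_apply ⟨x, hx⟩)⟩⟩
  rw [hfiber, Finset.card_map, Finset.card_univ, Fintype.card_equiv (Fintype.equivOfCardEq hcard)]

theorem sum_embedding_map_univ {α M : Type*} [Fintype α] [AddCommMonoid M]
    (F : {s : Finset α // s.card = r} → M) :
    ∑ k : Fin r ↪ α, F ⟨Finset.univ.map k, by simp⟩ = r ! • ∑ s, F s := by
  classical
  let image (k : Fin r ↪ α) : {s : Finset α // s.card = r} := ⟨Finset.univ.map k, by simp⟩
  change ∑ k, F (image k) = _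
  rw [← Finset.sum_fiberwise Finset.univ image, Finset.smul_sum]
  refine Finset.sum_congr rfl fun s _ => ?_
  have hcard := card_filter_map_eq (ι := Fin r) (s.2.trans (Fintype.card_fin r).symm)
  rw [Fintype.card_fin] at hcard
  rw [Finset.sum_congr rfl fun k hk => congrArg F (Finset.mem_filter.1 hk).2, Finset.sum_const,
    ← hcard]
  simp only [image, Subtype.ext_iff]

theorem sum_comp_pat {M : Type*} [AddCommMonoid M] (G : Equiv.Perm (Fin r) → M)
    (τ : Equiv.Perm (Fin n)) :
    ∑ s : {s : Finset (Fin n) // s.card = r}, G (pat s τ) = ∑ π, patternCount π τ • G π := by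
  classical
  simp only [patternCount, Fintype.card_subtype]
  exact (Finset.sum_comp G fun s => pat s τ).trans
    (Finset.sum_subset (Finset.subset_univ _) fun π _ hπ => by simp_all)

theorem sum_embedding_permOfPoints_graphPoint {M : Type*} [AddCommMonoid M] {u : Fin n → I}
    (hu : Function.Injective u) (ρ : Equiv.Perm (Fin n)) (G : Equiv.Perm (Fin r) → M) :
    ∑ k : Fin r ↪ Fin n, G (permOfPoints fun a => graphPoint ρ u (k a)) =
      r ! • ∑ π, patternCount π (standardize u * ρ * (standardize u)⁻¹) • G π := by
  rw [← sum_comp_pat,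
    ← sum_embedding_map_univ fun s => G (pat s (standardize u * ρ * (standardize u)⁻¹))]
  refine Fintype.sum_equiv ((Equiv.refl (Fin r)).embeddingCongr (standardize u)) _ _ fun k => ?_
  rw [permOfPoints_graphPoint hu ρ k (by simp)]
  rfl

end PatternsOfPoints

section CycleCounts

open Equiv Equiv.Perm

theorem card_filter_card_support_cycleOf {α : Type*} [Fintype α] [DecidableEq α] (ρ : Perm α)
    {p : ℕ} (hp : p ≠ 0) :
    (Finset.univ.filter fun i => (ρ.cycleOf i).support.card = p).card =
      p * ρ.cycleType.count p := by
  have hunion : (Finset.univ.filter fun i => (ρ.cycleOf i).support.card = p) =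
      (ρ.cycleFactorsFinset.filter fun c => c.support.card = p).biUnion support := by
    ext i
    simp only [Finset.mem_filter, Finset.mem_univ, true_and, Finset.mem_biUnion]
    constructor
    · intro hi
      have hmem : i ∈ ρ.support := by
        by_contra h
        rw [notMem_support, ← cycleOf_eq_one_iff] at h
        exact hp (by rw [← hi, h, support_one, Finset.card_empty])
      exact ⟨ρ.cycleOf i, ⟨cycleOf_mem_cycleFactorsFinset_iff.2 hmem, hi⟩,
        mem_support_cycleOf_iff.2 ⟨SameCycle.refl _ _, hmem⟩⟩
    · rintro ⟨c, ⟨hc, rfl⟩, hi⟩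
      rw [← cycle_is_cycleOf hi hc]
  rw [hunion, Finset.card_biUnion, Finset.sum_congr rfl fun c hc => (Finset.mem_filter.1 hc).2,
    Finset.sum_const, smul_eq_mul, mul_comm, cycleType_def, Multiset.count_map]
  · simp only [Function.comp_apply, eq_comm, ← Finset.card_val, Finset.filter_val]
    congr!
  · exact fun c hc d hd hcd => disjoint_iff_disjoint_support.1
      (ρ.cycleFactorsFinset_pairwise_disjoint (Finset.mem_filter.1 hc).1
        (Finset.mem_filter.1 hd).1 hcd)

theorem card_support_cycleOf_eq_two_iff {α : Type*} [Fintype α] [DecidableEq α] {ρ : Perm α}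
    {i : α} : (ρ.cycleOf i).support.card = 2 ↔ ρ i ≠ i ∧ ρ (ρ i) = i := by
  constructor
  · intro h
    refine ⟨two_le_card_support_cycleOf_iff.1 h.ge, ?_⟩
    simpa [h, pow_two] using (ρ.pow_mod_card_support_cycleOf_self_apply 2 i).symm
  · rintro ⟨hmove, hback⟩
    have hcycle := isCycle_cycleOf ρ hmove
    have hsq : ρ.cycleOf i ^ 2 = 1 :=
      hcycle.pow_eq_one_iff.2 ⟨i, by simpa using hmove, by simpa [cycleOf_pow_apply_self, pow_two]⟩
    refine le_antisymm ?_ (two_le_card_support_cycleOf_iff.2 hmove)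
    rw [← hcycle.orderOf]
    exact Nat.le_of_dvd two_pos (orderOf_dvd_of_pow_eq_one hsq)

variable {n : ℕ} {t : n.Partition} {ρ : Perm (Fin n)}

theorem card_fixedPoints_of_mem_cyclicClass (h : ρ ∈ cyclicClass t) :
    (Finset.univ.filter fun i => ρ i = i).card = numCycles t 1 := by
  have hone : (1 : ℕ) ∉ ρ.cycleType := fun h1 => by
    have := two_le_of_mem_cycleType h1
    omega
  rw [numCycles, ← show ρ.partition.parts = t.parts from h, parts_partition, Multiset.count_add,
    Multiset.count_eq_zero_of_notMem hone, Multiset.count_replicate_self, zero_add,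
    ← Finset.card_compl]
  congr 1
  ext i
  simp

theorem card_twoCyclePoints_of_mem_cyclicClass (h : ρ ∈ cyclicClass t) :
    (Finset.univ.filter fun i => ρ i ≠ i ∧ ρ (ρ i) = i).card = 2 * numCycles t 2 := by
  simp only [← card_support_cycleOf_eq_two_iff]
  rw [card_filter_card_support_cycleOf ρ two_ne_zero, numCycles,
    ← show ρ.partition.parts = t.parts from h, parts_partition, Multiset.count_add,
    Multiset.count_replicate, if_neg (by norm_num), add_zero]

theorem conj_mem_cyclicClass_iff (η : Perm (Fin n)) :
    η * ρ * η⁻¹ ∈ cyclicClass t ↔ ρ ∈ cyclicClass t := by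
  have : (η * ρ * η⁻¹).partition = ρ.partition :=
    partition_eq_of_isConj.1 (isConj_iff.2 ⟨η⁻¹, by group⟩)
  simp [cyclicClass, this]

end CycleCounts

section ProductMeasures

variable {ι : Type*} {E : ι → Type*} [∀ i, MeasurableSpace (E i)]

theorem exists_measurable_comp_restrict {β : Type*} [MeasurableSpace β] [∀ i, Nonempty (E i)]
    {X : (∀ i, E i) → β} (hX : Measurable X) {A : Finset ι} (hA : DependsOn X A) :
    ∃ Y : (∀ i : A, E i) → β, Measurable Y ∧ X = Y ∘ A.restrict := by
  classical
  let base : ∀ i, E i := fun _ => Classical.arbitrary _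
  refine ⟨fun v => X (Function.updateFinset base A v), hX.comp measurable_updateFinset, ?_⟩
  ext1 u
  exact hA fun i hi => by simp [Function.updateFinset, Finset.mem_coe.1 hi]

variable [Fintype ι] (ν : ∀ i, Measure (E i)) [∀ i, IsProbabilityMeasure (ν i)]

theorem indepFun_of_dependsOn {β γ : Type*} [MeasurableSpace β] [MeasurableSpace γ]
    {X : (∀ i, E i) → β} {Y : (∀ i, E i) → γ} (hX : Measurable X) (hY : Measurable Y)
    {A B : Finset ι} (hA : DependsOn X A) (hB : DependsOn Y B) (hAB : Disjoint A B) :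
    IndepFun X Y (Measure.pi ν) := by
  have (i : ι) : Nonempty (E i) := (ν i).nonempty_of_neZero
  have hcoord : iIndepFun (fun (i : ι) (ω : ∀ i, E i) => ω i) (Measure.pi ν) :=
    iIndepFun_pi (X := fun _ => id) fun _ => aemeasurable_id
  obtain ⟨X', hX', rfl⟩ := exists_measurable_comp_restrict hX hA
  obtain ⟨Y', hY', rfl⟩ := exists_measurable_comp_restrict hY hB
  exact (hcoord.indepFun_finset A B hAB fun i => measurable_pi_apply i).comp hX' hY'

theorem iIndepFun_of_dependsOn {κ : Type*} {β : κ → Type*} [∀ a, MeasurableSpace (β a)]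
    {X : ∀ a, (∀ i, E i) → β a} (hX : ∀ a, Measurable (X a)) {A : κ → Finset ι}
    (hA : ∀ a, DependsOn (X a) (A a)) (hdisj : Pairwise (Function.onFun Disjoint A)) :
    iIndepFun X (Measure.pi ν) := by
  classical
  refine iIndepFun_iff_measure_inter_preimage_eq_mul.2 fun T s hs => ?_
  induction T using Finset.induction_on with
  | empty => simp
  | insert a T ha ih =>
    have hmeas : MeasurableSet (⋂ b ∈ T, X b ⁻¹' s b) :=
      T.measurableSet_biInter fun b hb => hX b (hs b (Finset.mem_insert_of_mem hb))
    have hdep : DependsOn (fun ω => ω ∈ ⋂ b ∈ T, X b ⁻¹' s b) (T.biUnion A : Finset ι) :=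
      fun x y hxy => by
        simp only [Set.mem_iInter, Set.mem_preimage]
        refine propext (forall₂_congr fun b hb => ?_)
        rw [hA b fun i hi => hxy i (Finset.mem_biUnion.2 ⟨b, hb, hi⟩)]
    have hindep := indepFun_of_dependsOn ν (hX a) (measurable_mem.2 hmeas) (hA a) hdep
      ((Finset.disjoint_biUnion_right _ _ _).2 fun b hb => hdisj fun h => ha (h ▸ hb))
    have hpre : (fun ω => ω ∈ ⋂ b ∈ T, X b ⁻¹' s b) ⁻¹' {True} = ⋂ b ∈ T, X b ⁻¹' s b := by
      ext ω
      simp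
    have hmul := hindep.measure_inter_preimage_eq_mul (s a) {True}
      (hs a (Finset.mem_insert_self a T)) trivial
    rw [Finset.prod_insert ha, ← ih fun b hb => hs b (Finset.mem_insert_of_mem hb),
      Finset.set_biInter_insert]
    rwa [hpre] at hmul

theorem map_prodMk_apply {i j : ι} (hij : i ≠ j) :
    (Measure.pi ν).map (fun ω => (ω i, ω j)) = (ν i).prod (ν j) := by
  have hcoord : iIndepFun (fun (i : ι) (ω : ∀ i, E i) => ω i) (Measure.pi ν) :=
    iIndepFun_pi (X := fun _ => id) fun _ => aemeasurable_id
  rw [(indepFun_iff_map_prod_eq_prod_map_map (measurable_pi_apply i).aemeasurable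
    (measurable_pi_apply j).aemeasurable).1 (hcoord.indepFun hij),
    (measurePreserving_eval ν i).map_eq, (measurePreserving_eval ν j).map_eq]

theorem map_prodMk_prodMk_apply {i j l : ι} (hij : i ≠ j) (hil : i ≠ l) (hjl : j ≠ l) :
    (Measure.pi ν).map (fun ω => (ω i, ω j, ω l)) = (ν i).prod ((ν j).prod (ν l)) := by
  have hcoord : iIndepFun (fun (i : ι) (ω : ∀ i, E i) => ω i) (Measure.pi ν) :=
    iIndepFun_pi (X := fun _ => id) fun _ => aemeasurable_id
  have hindep := (hcoord.indepFun_prodMk measurable_pi_apply j l i hij.symm hil.symm).symm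
  rw [(indepFun_iff_map_prod_eq_prod_map_map (measurable_pi_apply i).aemeasurable
    (by fun_prop)).1 hindep, map_prodMk_apply ν hjl, (measurePreserving_eval ν i).map_eq]

theorem map_update_pi_prod [DecidableEq ι] (a : ι) (μ : Measure (E a)) [IsProbabilityMeasure μ] :
    ((Measure.pi ν).prod μ).map (fun p => Function.update p.1 a p.2) =
      Measure.pi (Function.update ν a μ) := by
  have (i : ι) : IsProbabilityMeasure (Function.update ν a μ i) := by
    rcases eq_or_ne i a with rfl | h
    · rwa [Function.update_self]
    · rw [Function.update_of_ne h]
      infer_instance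
  refine (Measure.pi_eq fun s hs => ?_).symm
  have hpre : (fun p : (∀ i, E i) × E a => Function.update p.1 a p.2) ⁻¹' Set.univ.pi s =
      Set.univ.pi (Function.update s a Set.univ) ×ˢ s a := by
    ext ⟨y, z⟩
    simp only [Set.mem_preimage, Set.mem_prod, Set.mem_univ_pi]
    rw [Function.forall_update_iff y fun i v => v ∈ s i,
      Function.forall_update_iff s fun i S => y i ∈ S]
    simp [and_comm]
  rw [Measure.map_apply measurable_update' (.univ_pi hs), hpre, Measure.prod_prod,
    Measure.pi_pi, mul_comm, ← Finset.mul_prod_erase Finset.univ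
    (fun i => Function.update ν a μ i (s i)) (Finset.mem_univ a),
    ← Finset.mul_prod_erase _ _ (Finset.mem_univ a)]
  simp only [Function.update_self, measure_univ, one_mul]
  congr 1
  refine Finset.prod_congr rfl fun i hi => ?_
  rw [Function.update_of_ne (Finset.ne_of_mem_erase hi),
    Function.update_of_ne (Finset.ne_of_mem_erase hi)]

theorem map_update_pi [DecidableEq ι] (a : ι) (z : E a) :
    (Measure.pi ν).map (fun y => Function.update y a z) =
      Measure.pi (Function.update ν a (Measure.dirac z)) := by
  rw [← map_update_pi_prod, Measure.prod_dirac, Measure.map_map measurable_update' (by fun_prop)]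
  rfl

theorem integral_integral_update [DecidableEq ι] (a : ι) {g : (∀ i, E i) → ℝ}
    (hg : Measurable g) {C : ℝ} (hC : ∀ y, |g y| ≤ C) :
    ∫ z, ∫ y, g (Function.update y a z) ∂Measure.pi ν ∂ν a = ∫ y, g y ∂Measure.pi ν := by
  conv_rhs => rw [← Function.update_eq_self a ν, ← map_update_pi_prod ν a]
  rw [integral_map measurable_update'.aemeasurable hg.aestronglyMeasurable, integral_prod_symm]
  exact .of_bound (hg.comp measurable_update').aestronglyMeasurable C (ae_of_all _ fun _ => hC _)

end ProductMeasures

theorem pi_sum_smul {ι J E : Type*} [Fintype ι] [DecidableEq ι] [Fintype J] [MeasurableSpace E]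
    (c : J → ENNReal) (ν : J → Measure E) [∀ j, SigmaFinite (ν j)]
    [SigmaFinite (∑ j, c j • ν j)] :
    Measure.pi (fun _ : ι => ∑ j, c j • ν j) =
      ∑ k : ι → J, (∏ a, c (k a)) • Measure.pi fun a => ν (k a) := by
  refine Measure.pi_eq fun s _ => ?_
  simp only [Measure.finsetSum_apply, Measure.smul_apply, Measure.pi_pi, smul_eq_mul,
    ← Finset.prod_mul_distrib]
  rw [Finset.prod_univ_sum, Fintype.piFinset_univ]

theorem ae_injective_of_ae_ne {Ω ι β : Type*} [MeasurableSpace Ω] [Countable ι] {μ : Measure Ω}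
    {X : Ω → ι → β}
    (h : ∀ i j, i ≠ j → ∀ᵐ ω ∂μ, X ω i ≠ X ω j) : ∀ᵐ ω ∂μ, Function.Injective (X ω) := by
  simp only [← ae_all_iff] at h
  filter_upwards [h] with ω hω i j hij
  exact not_imp_not.1 (hω i j) hij

section IndependentPairs

variable {Ω β γ : Type*} [MeasurableSpace Ω] [MeasurableSpace β] [MeasurableSpace γ]
  {μ : Measure Ω} [IsProbabilityMeasure μ]

theorem integral_prodMk_of_indepFun {X : Ω → β} {Y : Ω → γ} (hX : Measurable X)
    (hY : Measurable Y) (h : IndepFun X Y μ) {F : β × γ → ℝ} (hF : Measurable F) {C : ℝ}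
    (hC : ∀ p, |F p| ≤ C) :
    ∫ ω, F (X ω, Y ω) ∂μ = ∫ ω, ∫ ω', F (X ω', Y ω) ∂μ ∂μ := by
  have := Measure.isProbabilityMeasure_map (μ := μ) hX.aemeasurable
  have := Measure.isProbabilityMeasure_map (μ := μ) hY.aemeasurable
  have hlaw := (indepFun_iff_map_prod_eq_prod_map_map hX.aemeasurable hY.aemeasurable).1 h
  calc ∫ ω, F (X ω, Y ω) ∂μ
      = ∫ p, F p ∂(μ.map X).prod (μ.map Y) := by
        rw [← hlaw, integral_map (hX.prodMk hY).aemeasurable hF.aestronglyMeasurable]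
    _ = ∫ y, ∫ x, F (x, y) ∂μ.map X ∂μ.map Y :=
        integral_prod_symm _ (.of_bound hF.aestronglyMeasurable C (ae_of_all _ hC))
    _ = ∫ ω, ∫ x, F (x, Y ω) ∂μ.map X ∂μ :=
        integral_map hY.aemeasurable
          (hF.stronglyMeasurable.integral_prod_left' (μ := μ.map X)).aestronglyMeasurable
    _ = ∫ ω, ∫ ω', F (X ω', Y ω) ∂μ ∂μ := by
        refine integral_congr_ae (ae_of_all _ fun ω => ?_)
        exact integral_map hX.aemeasurable
          (hF.comp measurable_prodMk_right).aestronglyMeasurable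

theorem ae_ne_of_indepFun [MeasurableEq β] {X Y : Ω → β} (hX : Measurable X) (hY : Measurable Y)
    (h : IndepFun X Y μ) (hatom : ∀ x, μ (X ⁻¹' {x}) = 0) : ∀ᵐ ω ∂μ, X ω ≠ Y ω := by
  have hdiag : MeasurableSet (Set.diagonal β) := measurableSet_diagonal
  have hlaw := (indepFun_iff_map_prod_eq_prod_map_map hX.aemeasurable hY.aemeasurable).1 h
  have := Measure.isProbabilityMeasure_map (μ := μ) hX.aemeasurable
  have := Measure.isProbabilityMeasure_map (μ := μ) hY.aemeasurable
  have hzero : μ.map (fun ω => (X ω, Y ω)) (Set.diagonal β) = 0 := by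
    rw [hlaw, Measure.prod_apply_symm hdiag,
      lintegral_eq_zero_iff (measurable_measure_prodMk_right hdiag)]
    refine ae_of_all _ fun x => ?_
    exact (Measure.map_apply hX (measurable_prodMk_right hdiag)).trans (hatom x)
  rw [Measure.map_apply (hX.prodMk hY) hdiag] at hzero
  exact measure_eq_zero_iff_ae_notMem.1 hzero

end IndependentPairs

section PointLaws

/-- The uniform law on the diagonal of the unit square. -/
noncomputable def diagLaw : Measure (I × I) := (volume : Measure I).map fun u => (u, u)

instance : IsProbabilityMeasure diagLaw :=
  Measure.isProbabilityMeasure_map (by fun_prop)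

theorem isProbabilityMeasure_pointLaw {p : ℝ} (hp : p ∈ Set.Icc (0 : ℝ) 1) :
    IsProbabilityMeasure (pointLaw p) := by
  have : IsProbabilityMeasure ((volume : Measure I).map fun u => (u, u)) :=
    inferInstanceAs (IsProbabilityMeasure diagLaw)
  constructor
  simp only [pointLaw, Measure.add_apply, Measure.smul_apply, measure_univ, smul_eq_mul, mul_one]
  rw [← ENNReal.ofReal_add hp.1 (sub_nonneg.2 hp.2), add_sub_cancel, ENNReal.ofReal_one]

theorem pointLaw_fst_preimage_singleton (p : ℝ) (x : I) :
    pointLaw p (Prod.fst ⁻¹' {x}) = 0 := by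
  have hdiag : (volume : Measure I).map (fun u => (u, u)) (Prod.fst ⁻¹' {x}) = 0 := by
    rw [Measure.map_apply (by fun_prop) (measurable_fst (measurableSet_singleton x))]
    exact measure_singleton x
  have hsquare : (volume : Measure (I × I)) (Prod.fst ⁻¹' {x}) = 0 := by
    rw [← Set.prod_univ, Measure.volume_eq_prod, Measure.prod_prod, measure_singleton, zero_mul]
  simp [pointLaw, hdiag, hsquare]

theorem ae_injective_fst_update {ι : Type*} [Fintype ι] [DecidableEq ι] {p : ℝ}
    (hp : p ∈ Set.Icc (0 : ℝ) 1) (a : ι) (z : I × I) :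
    ∀ᵐ y ∂Measure.pi (fun _ : ι => pointLaw p),
      Function.Injective fun k => (Function.update y a z k).1 := by
  have := isProbabilityMeasure_pointLaw hp
  have hatom (i : ι) (x : I) : Measure.pi (fun _ : ι => pointLaw p) {y | (y i).1 = x} = 0 :=
    ((measurePreserving_eval (fun _ : ι => pointLaw p) i).measure_preimage
      (measurable_fst (measurableSet_singleton x)).nullMeasurableSet).trans
      (pointLaw_fst_preimage_singleton p x)
  have hcoord : iIndepFun (fun (i : ι) (y : ι → I × I) => (y i).1)
      (Measure.pi fun _ => pointLaw p) :=
    iIndepFun_pi (X := fun _ => Prod.fst) fun _ => measurable_fst.aemeasurable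
  have hz (i : ι) : ∀ᵐ y ∂Measure.pi (fun _ : ι => pointLaw p), (y i).1 ≠ z.1 :=
    measure_eq_zero_iff_ae_notMem.1 (hatom i z.1)
  refine ae_injective_of_ae_ne fun i j hij => ?_
  rcases eq_or_ne i a with rfl | hi
  · filter_upwards [hz j] with y hy
    simpa [hij.symm] using hy.symm
  rcases eq_or_ne j a with rfl | hj
  · filter_upwards [hz i] with y hy
    simpa [hi] using hy
  filter_upwards [ae_ne_of_indepFun (by fun_prop) (by fun_prop) (hcoord.indepFun hij) (hatom i)]
    with y hy
  simpa [hi, hj] using hy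

theorem ae_injective_pi {ι : Type*} [Fintype ι] :
    ∀ᵐ u ∂(volume : Measure (ι → I)), Function.Injective u := by
  have hcoord : iIndepFun (fun (i : ι) (u : ι → I) => u i) (Measure.pi fun _ => volume) :=
    iIndepFun_pi (X := fun _ => id) fun _ => aemeasurable_id
  refine ae_injective_of_ae_ne fun i j hij => ?_
  refine ae_ne_of_indepFun (measurable_pi_apply i) (measurable_pi_apply j)
    (hcoord.indepFun hij) fun x => ?_
  exact ((measurePreserving_eval (fun _ : ι => (volume : Measure I)) i).measure_preimage
    (measurableSet_singleton x).nullMeasurableSet).trans (measure_singleton x)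

end PointLaws

section GraphPoints

variable {ι : Type*}

/-- Nearness of two indices of the graph of `ρ`: the points `graphPoint ρ u i` and
`graphPoint ρ u j` share a coordinate of `u`, hence need not be independent. -/
def Near (ρ : Equiv.Perm ι) (i j : ι) : Prop := j = i ∨ j = ρ i ∨ i = ρ j

theorem Near.refl (ρ : Equiv.Perm ι) (i : ι) : Near ρ i i := Or.inl rfl

theorem Near.symm {ρ : Equiv.Perm ι} {i j : ι} (h : Near ρ i j) : Near ρ j i := by
  unfold Near at *
  tauto

theorem measurable_graphPoint {α : Type*} [MeasurableSpace α] (ρ : Equiv.Perm ι) (i : ι) :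
    Measurable fun u : ι → α => graphPoint ρ u i := by
  unfold graphPoint
  fun_prop

variable [DecidableEq ι]

instance (ρ : Equiv.Perm ι) (i j : ι) : Decidable (Near ρ i j) :=
  inferInstanceAs (Decidable (_ ∨ _))

theorem disjoint_of_not_near {ρ : Equiv.Perm ι} {i j : ι} (h : ¬ Near ρ i j) :
    Disjoint ({i, ρ i} : Finset ι) {j, ρ j} := by
  unfold Near at h
  push Not at h
  obtain ⟨hne, hsucc, hpred⟩ := h
  simp [hne, hsucc, hpred.symm]

theorem dependsOn_graphPoint {α : Type*} (ρ : Equiv.Perm ι) (i : ι) :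
    DependsOn (fun u : ι → α => graphPoint ρ u i) (({i, ρ i} : Finset ι) : Set ι) :=
  fun u v h => by simp [graphPoint, h i (by simp), h (ρ i) (by simp)]

/-- The law of `graphPoint ρ u i` for `u` uniform on the cube, see `map_graphPoint`. -/
noncomputable def pairLaw (ρ : Equiv.Perm ι) (i : ι) : Measure (I × I) :=
  if ρ i = i then diagLaw else volume

instance (ρ : Equiv.Perm ι) (i : ι) : IsProbabilityMeasure (pairLaw ρ i) := by
  unfold pairLaw
  split_ifs <;> infer_instance

variable [Fintype ι]

theorem map_graphPoint (ρ : Equiv.Perm ι) (i : ι) :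
    (volume : Measure (ι → I)).map (fun u => graphPoint ρ u i) = pairLaw ρ i := by
  unfold pairLaw graphPoint
  split_ifs with h
  · rw [h, diagLaw, ← (measurePreserving_eval (fun _ : ι => (volume : Measure I)) i).map_eq,
      Measure.map_map (by fun_prop) (by fun_prop)]
    rfl
  · exact map_prodMk_apply (fun _ => volume) (Ne.symm h)

theorem map_graphPoint_tuple {κ : Type*} [Fintype κ] (ρ : Equiv.Perm ι) {k : κ → ι}
    (hk : ∀ a b, a ≠ b → ¬ Near ρ (k a) (k b)) :
    (volume : Measure (ι → I)).map (fun u a => graphPoint ρ u (k a)) =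
      Measure.pi fun a => pairLaw ρ (k a) := by
  have hindep : iIndepFun (fun a (u : ι → I) => graphPoint ρ u (k a)) volume :=
    iIndepFun_of_dependsOn (fun _ => volume) (fun a => measurable_graphPoint ρ (k a))
      (fun a => dependsOn_graphPoint ρ (k a)) fun a b hab => disjoint_of_not_near (hk a b hab)
  rw [hindep.map_fun_eq_pi_map fun a => (measurable_graphPoint ρ (k a)).aemeasurable]
  simp only [map_graphPoint]

theorem pointLaw_eq_sum_pairLaw [Nonempty ι] (ρ : Equiv.Perm ι) :
    pointLaw (((Finset.univ.filter fun i => ρ i = i).card : ℝ) / Fintype.card ι) =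
      ∑ i, (Fintype.card ι : ENNReal)⁻¹ • pairLaw ρ i := by
  have hcard : (0 : ℝ) < Fintype.card ι := Nat.cast_pos.2 Fintype.card_pos
  have hweight (m : ℕ) :
      ENNReal.ofReal ((m : ℝ) / Fintype.card ι) = (Fintype.card ι : ENNReal)⁻¹ * m := by
    rw [ENNReal.ofReal_div_of_pos hcard, ENNReal.ofReal_natCast, ENNReal.ofReal_natCast,
      ENNReal.div_eq_inv_mul]
  have hmoved : 1 - ((Finset.univ.filter fun i => ρ i = i).card : ℝ) / Fintype.card ι =
      ((Finset.univ.filter fun i => ¬ ρ i = i).card : ℝ) / Fintype.card ι := by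
    rw [one_sub_div hcard.ne', ← Finset.card_univ,
      ← Finset.card_filter_add_card_filter_not fun i => ρ i = i]
    simp
  rw [← Finset.smul_sum]
  simp only [pairLaw]
  rw [Finset.sum_ite, Finset.sum_const, Finset.sum_const, smul_add, pointLaw, hmoved, hweight,
    hweight, ← Nat.cast_smul_eq_nsmul ENNReal, ← Nat.cast_smul_eq_nsmul ENNReal, smul_smul,
    smul_smul, diagLaw]

end GraphPoints

section BoundedIntegrals

variable {Ω : Type*} [MeasurableSpace Ω] {μ : Measure Ω} {f : Ω → ℝ} {C : ℝ}

theorem integrable_of_abs_le [IsFiniteMeasure μ] (hf : Measurable f) (hC : ∀ x, |f x| ≤ C) :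
    Integrable f μ :=
  .of_bound hf.aestronglyMeasurable C (ae_of_all _ hC)

theorem abs_integral_le_of_abs_le [IsProbabilityMeasure μ] (hC : ∀ x, |f x| ≤ C) :
    |∫ x, f x ∂μ| ≤ C := by
  simpa using norm_integral_le_of_norm_le_const (μ := μ) (f := f) (C := C) (ae_of_all _ hC)

theorem abs_mul_le_sq {x y B : ℝ} (hx : |x| ≤ B) (hy : |y| ≤ B) : |x * y| ≤ B ^ 2 := by
  rw [abs_mul, sq]
  exact mul_le_mul hx hy (abs_nonneg _) ((abs_nonneg _).trans hx)

theorem integral_abs_le_sqrt [IsProbabilityMeasure μ] (hf : Measurable f) (hC : ∀ x, |f x| ≤ C)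
    {K : ℝ} (hK : ∫ x, f x ^ 2 ∂μ ≤ K) : ∫ x, |f x| ∂μ ≤ √K := by
  have hmem : MemLp (fun x => |f x|) 2 μ :=
    (MemLp.of_bound hf.aestronglyMeasurable C (ae_of_all _ hC)).norm
  have hvar := variance_nonneg (fun x => |f x|) μ
  rw [variance_eq_sub hmem] at hvar
  simp only [Pi.pow_apply, sq_abs] at hvar
  exact Real.le_sqrt_of_sq_le (by linarith)

theorem integral_sum_sq_le_of_integral_mul_eq_zero [IsProbabilityMeasure μ] {J : Type*} [Fintype J]
    {W : J → Ω → ℝ} {B : ℝ} (hW : ∀ j, Measurable (W j)) (hB : ∀ j x, |W j x| ≤ B)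
    {R : J × J → Prop} [DecidablePred R]
    (hR : ∀ p, ¬ R p → ∫ x, W p.1 x * W p.2 x ∂μ = 0) :
    ∫ x, (∑ j, W j x) ^ 2 ∂μ ≤ (Finset.univ.filter R).card * B ^ 2 := by
  have hbound (p : J × J) (x : Ω) : |W p.1 x * W p.2 x| ≤ B ^ 2 :=
    abs_mul_le_sq (hB p.1 x) (hB p.2 x)
  have hsq (x : Ω) : (∑ j, W j x) ^ 2 = ∑ p : J × J, W p.1 x * W p.2 x := by
    rw [sq, Finset.sum_mul_sum, ← Finset.sum_product', Finset.univ_product_univ]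
  calc ∫ x, (∑ j, W j x) ^ 2 ∂μ
      = ∑ p : J × J, ∫ x, W p.1 x * W p.2 x ∂μ := by
        simp only [hsq]
        exact integral_finsetSum _ fun p _ =>
          integrable_of_abs_le ((hW p.1).mul (hW p.2)) (hbound p)
    _ ≤ ∑ p : J × J, if R p then B ^ 2 else 0 := by
        refine Finset.sum_le_sum fun p _ => ?_
        split_ifs with hp
        · exact (le_abs_self _).trans (abs_integral_le_of_abs_le (hbound p))
        · exact (hR p hp).le
    _ = (Finset.univ.filter R).card * B ^ 2 := by
        rw [← Finset.sum_filter, Finset.sum_const, nsmul_eq_mul]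

end BoundedIntegrals

section HoeffdingDecomposition

variable {κ E : Type*} [Fintype κ] [DecidableEq κ] [MeasurableSpace E]

/-- The first order Hoeffding projection of `g`: the mean of `g` at independent variables of laws
`ν b`, the `a`-th one being frozen at `z`. -/
noncomputable def hoeffdingProj (ν : κ → Measure E) (g : (κ → E) → ℝ) (a : κ) (z : E) : ℝ :=
  ∫ y, g (Function.update y a z) ∂Measure.pi ν

/-- The degenerate part of `g` in its Hoeffding decomposition at independent variables of laws
`ν b`: what remains once the mean and the centred first order projections are removed. -/
noncomputable def hoeffdingRem (ν : κ → Measure E) (g : (κ → E) → ℝ) (z : κ → E) : ℝ :=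
  g z - ∫ y, g y ∂Measure.pi ν - ∑ a, (hoeffdingProj ν g a (z a) - ∫ y, g y ∂Measure.pi ν)

variable (ν : κ → Measure E) [∀ a, IsProbabilityMeasure (ν a)] {g : (κ → E) → ℝ} {C : ℝ}

theorem measurable_hoeffdingProj (hg : Measurable g) (a : κ) :
    Measurable (hoeffdingProj ν g a) :=
  ((hg.comp measurable_update').stronglyMeasurable.integral_prod_left'
    (μ := Measure.pi ν)).measurable

theorem abs_hoeffdingProj_le (hC : ∀ y, |g y| ≤ C) (a : κ) (z : E) :
    |hoeffdingProj ν g a z| ≤ C :=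
  abs_integral_le_of_abs_le fun _ => hC _

theorem integral_hoeffdingProj (hg : Measurable g) (hC : ∀ y, |g y| ≤ C) (a : κ) :
    ∫ z, hoeffdingProj ν g a z ∂ν a = ∫ y, g y ∂Measure.pi ν :=
  integral_integral_update ν a hg hC

theorem hoeffdingProj_update (hg : Measurable g) (a : κ) (μ : Measure E) [IsProbabilityMeasure μ] :
    hoeffdingProj (Function.update ν a μ) g a = hoeffdingProj ν g a := by
  have (b : κ) : IsProbabilityMeasure (Function.update ν a μ b) := by
    rcases eq_or_ne b a with rfl | h
    · rwa [Function.update_self]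
    · rw [Function.update_of_ne h]
      infer_instance
  have hfrozen (ν : κ → Measure E) [∀ b, IsProbabilityMeasure (ν b)] (z : E) :
      hoeffdingProj ν g a z = ∫ y, g y ∂Measure.pi (Function.update ν a (Measure.dirac z)) := by
    rw [← map_update_pi, integral_map (by fun_prop) hg.aestronglyMeasurable, hoeffdingProj]
  ext z
  rw [hfrozen, hfrozen, Function.update_idem]

theorem measurable_hoeffdingRem (hg : Measurable g) : Measurable (hoeffdingRem ν g) :=
  (hg.sub_const _).sub (Finset.measurable_sum _ fun a _ =>
    ((measurable_hoeffdingProj ν hg a).comp (measurable_pi_apply a)).sub_const _)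

theorem abs_hoeffdingRem_le (hC : ∀ y, |g y| ≤ C) (z : κ → E) :
    |hoeffdingRem ν g z| ≤ 2 * (Fintype.card κ + 1) * C := by
  have hmean : |∫ y, g y ∂Measure.pi ν| ≤ C := abs_integral_le_of_abs_le hC
  have hproj : |∑ a, (hoeffdingProj ν g a (z a) - ∫ y, g y ∂Measure.pi ν)| ≤
      Fintype.card κ * (2 * C) := by
    rw [← nsmul_eq_mul, ← Finset.card_univ, ← Finset.sum_const]
    refine (Finset.abs_sum_le_sum_abs _ _).trans (Finset.sum_le_sum fun a _ => ?_)
    linarith [abs_sub (hoeffdingProj ν g a (z a)) (∫ y, g y ∂Measure.pi ν),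
      abs_hoeffdingProj_le ν hC a (z a)]
  unfold hoeffdingRem
  linarith [hC z, abs_sub (g z) (∫ y, g y ∂Measure.pi ν), abs_sub (g z - ∫ y, g y ∂Measure.pi ν)
    (∑ a, (hoeffdingProj ν g a (z a) - ∫ y, g y ∂Measure.pi ν))]

theorem integral_hoeffdingProj_update_apply (hg : Measurable g) (hC : ∀ y, |g y| ≤ C) (a b : κ)
    (z : E) :
    ∫ y, hoeffdingProj ν g b (Function.update y a z b) ∂Measure.pi ν =
      if b = a then hoeffdingProj ν g a z else ∫ y, g y ∂Measure.pi ν := by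
  split_ifs with h
  · subst h
    simp
  · simp only [Function.update_of_ne h]
    rw [← integral_hoeffdingProj ν hg hC b, ← (measurePreserving_eval ν b).map_eq]
    exact (integral_map (measurable_pi_apply b).aemeasurable
      (measurable_hoeffdingProj ν hg b).aestronglyMeasurable).symm

theorem integral_hoeffdingRem_update (hg : Measurable g) (hC : ∀ y, |g y| ≤ C) (a : κ) (z : E) :
    ∫ y, hoeffdingRem ν g (Function.update y a z) ∂Measure.pi ν = 0 := by
  have hfreeze : Measurable fun y : κ → E => Function.update y a z := by fun_prop
  have hgint : Integrable (fun y => g (Function.update y a z)) (Measure.pi ν) :=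
    integrable_of_abs_le (hg.comp hfreeze) fun y => hC _
  have hgcentred : Integrable (fun y => g (Function.update y a z) - ∫ y, g y ∂Measure.pi ν)
      (Measure.pi ν) := hgint.sub (integrable_const _)
  have hprojint (b : κ) : Integrable
      (fun y => hoeffdingProj ν g b (Function.update y a z b)) (Measure.pi ν) :=
    integrable_of_abs_le
      ((measurable_hoeffdingProj ν hg b).comp ((measurable_pi_apply b).comp hfreeze))
      fun y => abs_hoeffdingProj_le ν hC b _
  have hcentred (b : κ) : Integrable (fun y => hoeffdingProj ν g b (Function.update y a z b) -
      ∫ y, g y ∂Measure.pi ν) (Measure.pi ν) := (hprojint b).sub (integrable_const _)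
  have hterm (b : κ) : ∫ y, (hoeffdingProj ν g b (Function.update y a z b) -
      ∫ y, g y ∂Measure.pi ν) ∂Measure.pi ν =
      if b = a then hoeffdingProj ν g a z - ∫ y, g y ∂Measure.pi ν else 0 := by
    rw [integral_sub (hprojint b) (integrable_const _),
      integral_hoeffdingProj_update_apply ν hg hC]
    split_ifs <;> simp
  unfold hoeffdingRem
  rw [integral_sub hgcentred (integrable_finsetSum _ fun b _ => hcentred b),
    integral_finsetSum _ fun b _ => hcentred b, integral_sub hgint (integrable_const _)]
  simp only [hterm]
  simp [hoeffdingProj]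

end HoeffdingDecomposition

section NearTuples

variable {ι : Type*}

/-- The maps sending an index to the indices near it, see `near_iff_exists_cycleStep`. -/
def cycleStep (ρ : Equiv.Perm ι) : Fin 3 → Equiv.Perm ι := ![1, ρ, ρ⁻¹]

theorem near_iff_exists_cycleStep {ρ : Equiv.Perm ι} {i j : ι} :
    Near ρ i j ↔ ∃ c, j = cycleStep ρ c i := by
  simp only [Near, cycleStep, Fin.exists_fin_succ]
  simp [Equiv.eq_symm_apply, eq_comm]

/-- At least two entries of the tuple `m`, at the positions `p` and `q`, are near entries at other
positions, neither of them being `p` or `q`: such tuples are determined, up to finitely many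
choices, by all but two of their entries. -/
def DoublyNear {K : Type*} (ρ : Equiv.Perm ι) (m : K → ι) : Prop :=
  ∃ p q p' q' : K, (p ≠ q ∧ p' ≠ p ∧ p' ≠ q ∧ q' ≠ p ∧ q' ≠ q) ∧
    Near ρ (m p') (m p) ∧ Near ρ (m q') (m q)

/-- The entries of `k` other than the `a`-th one are near no other entry of `k` and no entry of
`l`. -/
def IsolatedExcept {κ : Type*} (ρ : Equiv.Perm ι) (k l : κ → ι) (a : κ) : Prop :=
  ∀ b ≠ a, (∀ c ≠ b, ¬ Near ρ (k b) (k c)) ∧ ∀ c, ¬ Near ρ (k b) (l c)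

theorem IsolatedExcept.not_near {κ : Type*} {ρ : Equiv.Perm ι} {k l : κ → ι} {a : κ}
    (h : IsolatedExcept ρ k l a) {b c : κ} (hbc : b ≠ c) : ¬ Near ρ (k b) (k c) := by
  rcases eq_or_ne b a with rfl | hb
  · exact fun hnear => (h c hbc.symm).1 b hbc hnear.symm
  · exact (h b hb).1 c hbc.symm

theorem exists_near_of_not_isolatedExcept {κ : Type*} {ρ : Equiv.Perm ι} {k l : κ → ι} {a : κ}
    (h : ¬ IsolatedExcept ρ k l a) :
    ∃ b ≠ a, ∃ q ≠ Sum.inl b, Near ρ (k b) (Sum.elim k l q) := by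
  unfold IsolatedExcept at h
  push Not at h
  obtain ⟨b, hba, hb⟩ := h
  by_cases hk : ∀ c ≠ b, ¬ Near ρ (k b) (k c)
  · obtain ⟨c, hc⟩ := hb hk
    exact ⟨b, hba, Sum.inr c, by simp, hc⟩
  · push Not at hk
    obtain ⟨c, hcb, hc⟩ := hk
    exact ⟨b, hba, Sum.inl c, by simpa using hcb, hc⟩

theorem doublyNear_of_near {K : Type*} {ρ : Equiv.Perm ι} {m : K → ι} {p q x y : K} (hqp : q ≠ p)
    (hqx : q ≠ x) (hxp : x ≠ p) (hyq : y ≠ q) (hpx : Near ρ (m p) (m x))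
    (hqy : Near ρ (m q) (m y)) : DoublyNear ρ m := by
  rcases eq_or_ne y p with rfl | hyp
  · exact ⟨x, q, y, y, ⟨hqx.symm, hxp.symm, hqp.symm, hxp.symm, hqp.symm⟩, hpx, hqy.symm⟩
  · exact ⟨p, q, x, y, ⟨hqp.symm, hxp, hqx.symm, hyp, hyq⟩, hpx.symm, hqy.symm⟩

theorem exists_isolatedExcept_of_not_doublyNear {κ : Type*} [Nonempty κ] {ρ : Equiv.Perm ι}
    {k l : κ → ι} (h : ¬ DoublyNear ρ (Sum.elim k l)) :
    (∃ a, IsolatedExcept ρ k l a) ∨ ∃ a, IsolatedExcept ρ l k a := by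
  by_contra! hnot
  obtain ⟨b, -, x, hxb, hbx⟩ :=
    exists_near_of_not_isolatedExcept (hnot.1 (Classical.arbitrary κ))
  obtain ⟨b', hb', x', hxb', hbx'⟩ := exists_near_of_not_isolatedExcept (hnot.1 b)
  obtain ⟨c, -, y, hyc, hcy⟩ :=
    exists_near_of_not_isolatedExcept (hnot.2 (Classical.arbitrary κ))
  by_cases hxc : Sum.inr c = x
  · exact h (doublyNear_of_near (p := Sum.inl b) (q := Sum.inl b') (by simpa using hb')
      (by simp [← hxc]) hxb hxb' hbx hbx')
  · have hy : Near ρ (Sum.elim k l (Sum.inr c)) (Sum.elim k l y.swap) := by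
      rcases y with y | y <;> exact hcy
    exact h (doublyNear_of_near (p := Sum.inl b) (q := Sum.inr c) (by simp) hxc hxb
      (by rcases y with y | y; exacts [by simpa using hyc, by simp]) hbx hy)

variable [Fintype ι] {K : Type*} [Fintype K] [DecidableEq K]

theorem card_filter_eq_apply_and_eq_apply_le [DecidableEq ι] (f f' : ι → ι) {p q p' q' : K}
    (h : p ≠ q ∧ p' ≠ p ∧ p' ≠ q ∧ q' ≠ p ∧ q' ≠ q) :
    (Finset.univ.filter fun m : K → ι => m p = f (m p') ∧ m q = f' (m q')).card ≤
      Fintype.card ι ^ (Fintype.card K - 2) := by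
  obtain ⟨hpq, hp, hpq', hqp', hq⟩ := h
  have hcard : Fintype.card {x : K // x ≠ p ∧ x ≠ q} = Fintype.card K - 2 := by
    rw [Fintype.card_subtype, ← Finset.card_univ, ← Finset.card_pair hpq,
      ← Finset.card_sdiff_of_subset (Finset.subset_univ _)]
    congr 1
    ext x
    simp
  rw [← hcard, ← Fintype.card_fun, ← Finset.card_univ]
  refine Finset.card_le_card_of_injOn (fun m x => m x) (fun _ _ => Finset.mem_univ _) ?_
  intro m hm m' hm' hmm'
  obtain ⟨hmp, hmq⟩ := (Finset.mem_filter.1 hm).2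
  obtain ⟨hmp', hmq'⟩ := (Finset.mem_filter.1 hm').2
  have heq (x : K) (hxp : x ≠ p) (hxq : x ≠ q) : m x = m' x := congrFun hmm' ⟨x, hxp, hxq⟩
  ext1 x
  rcases eq_or_ne x p with rfl | hxp
  · rw [hmp, hmp', heq p' hp hpq']
  · rcases eq_or_ne x q with rfl | hxq
    · rw [hmq, hmq', heq q' hqp' hq]
    · exact heq x hxp hxq

theorem card_filter_near_and_near_le [DecidableEq ι] (ρ : Equiv.Perm ι) {p q p' q' : K}
    (h : p ≠ q ∧ p' ≠ p ∧ p' ≠ q ∧ q' ≠ p ∧ q' ≠ q) :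
    (Finset.univ.filter fun m : K → ι => Near ρ (m p') (m p) ∧ Near ρ (m q') (m q)).card ≤
      9 * Fintype.card ι ^ (Fintype.card K - 2) := by
  have hsub : (Finset.univ.filter fun m : K → ι => Near ρ (m p') (m p) ∧ Near ρ (m q') (m q)) ⊆
      Finset.univ.biUnion fun c : Fin 3 × Fin 3 => Finset.univ.filter fun m : K → ι =>
        m p = cycleStep ρ c.1 (m p') ∧ m q = cycleStep ρ c.2 (m q') := by
    intro m hm
    simpa [near_iff_exists_cycleStep] using hm
  refine (Finset.card_le_card hsub).trans (Finset.card_biUnion_le.trans ?_)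
  refine (Finset.sum_le_sum fun c _ => card_filter_eq_apply_and_eq_apply_le _ _ h).trans ?_
  simp

open scoped Classical in
theorem card_filter_doublyNear_le (ρ : Equiv.Perm ι) :
    (Finset.univ.filter fun m : K → ι => DoublyNear ρ m).card ≤
      Fintype.card K ^ 4 * (9 * Fintype.card ι ^ (Fintype.card K - 2)) := by
  let S : Finset (K × K × K × K) := Finset.univ.filter fun s =>
    s.1 ≠ s.2.1 ∧ s.2.2.1 ≠ s.1 ∧ s.2.2.1 ≠ s.2.1 ∧ s.2.2.2 ≠ s.1 ∧ s.2.2.2 ≠ s.2.1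
  have hsub : (Finset.univ.filter fun m : K → ι => DoublyNear ρ m) ⊆ S.biUnion fun s =>
      Finset.univ.filter fun m : K → ι =>
        Near ρ (m s.2.2.1) (m s.1) ∧ Near ρ (m s.2.2.2) (m s.2.1) := by
    intro m hm
    obtain ⟨p, q, p', q', hdistinct, hnear⟩ := (Finset.mem_filter.1 hm).2
    exact Finset.mem_biUnion.2 ⟨(p, q, p', q'), by simpa [S] using hdistinct, by simpa using hnear⟩
  calc (Finset.univ.filter fun m : K → ι => DoublyNear ρ m).card
      ≤ ∑ _s ∈ S, 9 * Fintype.card ι ^ (Fintype.card K - 2) :=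
        (Finset.card_le_card hsub).trans (Finset.card_biUnion_le.trans
          (Finset.sum_le_sum fun s hs => card_filter_near_and_near_le ρ (Finset.mem_filter.1 hs).2))
    _ ≤ Fintype.card K ^ 4 * (9 * Fintype.card ι ^ (Fintype.card K - 2)) := by
        rw [Finset.sum_const, smul_eq_mul]
        refine Nat.mul_le_mul_right _ ((Finset.card_filter_le _ _).trans_eq ?_)
        simp only [Finset.card_univ, Fintype.card_prod]
        ring

end NearTuples

section DegeneratePart

theorem measurable_graphPoint_tuple {ι κ α : Type*} [MeasurableSpace α] (ρ : Equiv.Perm ι)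
    (k : κ → ι) : Measurable fun (u : ι → α) a => graphPoint ρ u (k a) :=
  measurable_pi_lambda _ fun a => measurable_graphPoint ρ (k a)

theorem indepFun_update_graphPoint {ι κ : Type*} [Fintype ι] [Finite κ] [DecidableEq κ]
    {ρ : Equiv.Perm ι} {k l : κ → ι} {a : κ}
    (h : IsolatedExcept ρ k l a) :
    IndepFun (fun u : ι → I => Function.update (fun b => graphPoint ρ u (k b)) a 0)
      (fun u => (graphPoint ρ u (k a), fun b => graphPoint ρ u (l b))) volume := by
  classical
  cases nonempty_fintype κ
  let S (i : ι) : Finset ι := {i, ρ i}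
  refine indepFun_of_dependsOn (fun _ => volume)
    (A := (Finset.univ.erase a).biUnion fun b => S (k b))
    (B := S (k a) ∪ Finset.univ.biUnion fun b => S (l b)) ?_ ?_ ?_ ?_ ?_
  · have hupdate : Measurable fun y : κ → I × I => Function.update y a 0 := by fun_prop
    exact hupdate.comp (measurable_graphPoint_tuple ρ k)
  · exact (measurable_graphPoint ρ (k a)).prodMk (measurable_graphPoint_tuple ρ l)
  · intro u v huv
    ext1 b
    rcases eq_or_ne b a with rfl | hb
    · simp
    · simp only [Function.update_of_ne hb]
      exact dependsOn_graphPoint ρ (k b) fun i hi =>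
        huv i (Finset.mem_biUnion.2 ⟨b, Finset.mem_erase.2 ⟨hb, Finset.mem_univ b⟩, hi⟩)
  · intro u v huv
    refine Prod.ext ?_ (funext fun b => ?_)
    · exact dependsOn_graphPoint ρ (k a) fun i hi => huv i (Finset.mem_union_left _ hi)
    · exact dependsOn_graphPoint ρ (l b) fun i hi => huv i (Finset.mem_union_right _
        (Finset.mem_biUnion.2 ⟨b, Finset.mem_univ b, hi⟩))
  · rw [Finset.disjoint_biUnion_left]
    intro b hb
    have hba : b ≠ a := (Finset.mem_erase.1 hb).1
    rw [Finset.disjoint_union_right, Finset.disjoint_biUnion_right]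
    exact ⟨disjoint_of_not_near (h.not_near hba), fun c _ => disjoint_of_not_near ((h b hba).2 c)⟩

variable {ι κ : Type*} [DecidableEq ι] [Fintype κ] [DecidableEq κ]
  {g : (κ → I × I) → ℝ} {C : ℝ}

/-- The degenerate part of the Hoeffding decomposition of `g` at the points of the graph of `ρ`
with indices `k a`. -/
noncomputable def graphRem (ρ : Equiv.Perm ι) (g : (κ → I × I) → ℝ) (k : κ → ι) (u : ι → I) : ℝ :=
  hoeffdingRem (fun a => pairLaw ρ (k a)) g fun a => graphPoint ρ u (k a)

theorem measurable_graphRem (ρ : Equiv.Perm ι) (hg : Measurable g) (k : κ → ι) :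
    Measurable (graphRem ρ g k) :=
  (measurable_hoeffdingRem _ hg).comp (measurable_graphPoint_tuple ρ k)

variable [Fintype ι]

theorem integral_graphRem_mul_graphRem_eq_zero {ρ : Equiv.Perm ι} (hg : Measurable g)
    (hC : ∀ y, |g y| ≤ C) {k l : κ → ι} {a : κ} (h : IsolatedExcept ρ k l a) :
    ∫ u, graphRem ρ g k u * graphRem ρ g l u = 0 := by
  let X (u : ι → I) : κ → I × I := Function.update (fun b => graphPoint ρ u (k b)) a 0
  let Y (u : ι → I) : (I × I) × (κ → I × I) :=
    (graphPoint ρ u (k a), fun b => graphPoint ρ u (l b))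
  let F (p : (κ → I × I) × ((I × I) × (κ → I × I))) : ℝ :=
    hoeffdingRem (fun b => pairLaw ρ (k b)) g (Function.update p.1 a p.2.1) *
      hoeffdingRem (fun b => pairLaw ρ (l b)) g p.2.2
  have hX : Measurable X := by
    have hupdate : Measurable fun y : κ → I × I => Function.update y a 0 := by fun_prop
    exact hupdate.comp (measurable_graphPoint_tuple ρ k)
  have hY : Measurable Y :=
    (measurable_graphPoint ρ (k a)).prodMk (measurable_graphPoint_tuple ρ l)
  have hF : Measurable F :=
    ((measurable_hoeffdingRem _ hg).comp (measurable_update'.comp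
      (measurable_fst.prodMk (measurable_fst.comp measurable_snd)))).mul
    ((measurable_hoeffdingRem _ hg).comp (measurable_snd.comp measurable_snd))
  have hFC (p) : |F p| ≤ (2 * (Fintype.card κ + 1) * C) ^ 2 :=
    abs_mul_le_sq (abs_hoeffdingRem_le _ hC _) (abs_hoeffdingRem_le _ hC _)
  have hFXY (u : ι → I) : F (X u, Y u) = graphRem ρ g k u * graphRem ρ g l u := by
    simp [F, X, Y, graphRem]
  -- Freezing the `a`-th point, the other ones are independent, so that degeneracy applies.
  have hzero (z : I × I) : ∫ u, hoeffdingRem (fun b => pairLaw ρ (k b)) g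
      (Function.update (X u) a z) = 0 := by
    simp only [X, Function.update_idem]
    rw [← integral_hoeffdingRem_update (fun b => pairLaw ρ (k b)) hg hC a z,
      ← map_graphPoint_tuple ρ fun b c => h.not_near]
    refine (integral_map (measurable_graphPoint_tuple ρ k).aemeasurable
      (f := fun y => hoeffdingRem _ g (Function.update y a z))
      ((measurable_hoeffdingRem _ hg).comp ?_).aestronglyMeasurable).symm
    fun_prop
  simp only [← hFXY]
  rw [integral_prodMk_of_indepFun hX hY (indepFun_update_graphPoint h) hF hFC]
  simp only [F, integral_mul_const, hzero, zero_mul, integral_zero]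

theorem integral_sum_graphRem_sq_le [Nonempty κ] (ρ : Equiv.Perm ι) (hg : Measurable g)
    (hC : ∀ y, |g y| ≤ C) :
    ∫ u, (∑ k : κ → ι, graphRem ρ g k u) ^ 2 ≤
      (2 * Fintype.card κ) ^ 4 * (9 * (Fintype.card ι : ℝ) ^ (2 * Fintype.card κ - 2)) *
        (2 * (Fintype.card κ + 1) * C) ^ 2 := by
  classical
  have hzero (p : (κ → ι) × (κ → ι)) (hp : ¬ DoublyNear ρ (Sum.elim p.1 p.2)) :
      ∫ u, graphRem ρ g p.1 u * graphRem ρ g p.2 u = 0 := by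
    rcases exists_isolatedExcept_of_not_doublyNear hp with ⟨a, ha⟩ | ⟨a, ha⟩
    · exact integral_graphRem_mul_graphRem_eq_zero hg hC ha
    · simp only [mul_comm (graphRem ρ g p.1 _)]
      exact integral_graphRem_mul_graphRem_eq_zero hg hC ha
  have hcard : (Finset.univ.filter fun p : (κ → ι) × (κ → ι) =>
      DoublyNear ρ (Sum.elim p.1 p.2)).card ≤
      (2 * Fintype.card κ) ^ 4 * (9 * Fintype.card ι ^ (2 * Fintype.card κ - 2)) := by
    have hle := card_filter_doublyNear_le (K := κ ⊕ κ) ρ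
    rw [Fintype.card_sum, ← two_mul] at hle
    refine le_of_eq_of_le ?_ hle
    exact Finset.card_equiv (Equiv.sumArrowEquivProdArrow κ κ ι).symm fun p => by
      simp [Equiv.sumArrowEquivProdArrow]
  refine (integral_sum_sq_le_of_integral_mul_eq_zero (measurable_graphRem ρ hg)
    (fun k u => abs_hoeffdingRem_le _ hC _) hzero).trans ?_
  exact mul_le_mul_of_nonneg_right (by exact_mod_cast hcard) (sq_nonneg _)

end DegeneratePart

section Mixtures

theorem abs_prod_sub_prod_le {ι : Type*} (s : Finset ι) {x y : ι → ℝ} (hx : ∀ i, |x i| ≤ 1)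
    (hy : ∀ i, |y i| ≤ 1) : |∏ i ∈ s, x i - ∏ i ∈ s, y i| ≤ ∑ i ∈ s, |x i - y i| := by
  classical
  induction s using Finset.induction_on with
  | empty => simp
  | insert a s ha ih =>
    have hsplit : x a * ∏ i ∈ s, x i - y a * ∏ i ∈ s, y i =
        (x a - y a) * ∏ i ∈ s, x i + y a * (∏ i ∈ s, x i - ∏ i ∈ s, y i) := by ring
    have hprod : |∏ i ∈ s, x i| ≤ 1 := by
      rw [Finset.abs_prod]
      exact Finset.prod_le_one (fun i _ => abs_nonneg _) fun i _ => hx i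
    rw [Finset.prod_insert ha, Finset.prod_insert ha, Finset.sum_insert ha, hsplit]
    refine (abs_add_le _ _).trans (add_le_add ?_ ?_)
    · rw [abs_mul]
      exact mul_le_of_le_one_right (abs_nonneg _) hprod
    · rw [abs_mul]
      exact (mul_le_of_le_one_left (abs_nonneg _) (hy a)).trans ih

theorem integral_pi_sum_smul {κ J E : Type*} [Fintype κ] [DecidableEq κ] [Fintype J]
    [MeasurableSpace E] {c : J → ENNReal} (hc : ∀ j, c j ≠ ⊤) (ν : J → Measure E)
    [∀ j, IsProbabilityMeasure (ν j)] {G : (κ → E) → ℝ} (hG : Measurable G) {C : ℝ}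
    (hC : ∀ y, |G y| ≤ C) :
    ∫ y, G y ∂Measure.pi (fun _ : κ => ∑ j, c j • ν j) =
      ∑ k : κ → J, (∏ a, (c (k a)).toReal) * ∫ y, G y ∂Measure.pi fun a => ν (k a) := by
  have (j : J) : IsFiniteMeasure (c j • ν j) := Measure.smul_finite _ (hc j)
  rw [pi_sum_smul, integral_finsetSum_measure fun k _ =>
    (integrable_of_abs_le hG hC).smul_measure (ENNReal.prod_ne_top fun a _ => hc _)]
  exact Finset.sum_congr rfl fun k _ => by
    rw [integral_smul_measure, ENNReal.toReal_prod, smul_eq_mul]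

theorem pointLaw_eq_sum_bool (p : ℝ) :
    pointLaw p = ∑ b : Bool, ENNReal.ofReal (bif b then p else 1 - p) •
      (bif b then diagLaw else (volume : Measure (I × I))) := by
  simp [pointLaw, diagLaw]

theorem abs_prod_cond_sub_le {κ : Type*} [Fintype κ] {p q : ℝ} (hp : p ∈ Set.Icc (0 : ℝ) 1)
    (hq : q ∈ Set.Icc (0 : ℝ) 1) (k : κ → Bool) :
    |∏ a, (bif k a then p else 1 - p) - ∏ a, (bif k a then q else 1 - q)| ≤
      Fintype.card κ * |p - q| := by
  have hle {x : ℝ} (hx : x ∈ Set.Icc (0 : ℝ) 1) (b : Bool) : |bif b then x else 1 - x| ≤ 1 := by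
    cases b <;> simp only [cond_true, cond_false, abs_le] <;> constructor <;>
      linarith [hx.1, hx.2]
  have hdiff (b : Bool) : |(bif b then p else 1 - p) - (bif b then q else 1 - q)| = |p - q| := by
    cases b
    · rw [cond_false, cond_false, sub_sub_sub_cancel_left, abs_sub_comm]
    · rfl
  refine (abs_prod_sub_prod_le _ (fun a => hle hp (k a)) fun a => hle hq (k a)).trans ?_
  simp [hdiff]

theorem abs_integral_pi_pointLaw_sub_le {κ : Type*} [Fintype κ] {p q : ℝ}
    (hp : p ∈ Set.Icc (0 : ℝ) 1) (hq : q ∈ Set.Icc (0 : ℝ) 1) {G : (κ → I × I) → ℝ}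
    (hG : Measurable G) {C : ℝ} (hC : ∀ y, |G y| ≤ C) :
    |∫ y, G y ∂Measure.pi (fun _ => pointLaw p) - ∫ y, G y ∂Measure.pi (fun _ => pointLaw q)| ≤
      2 ^ Fintype.card κ * (Fintype.card κ * C) * |p - q| := by
  classical
  have (b : Bool) : IsProbabilityMeasure (bif b then diagLaw else (volume : Measure (I × I))) := by
    cases b <;> simp only [cond_true, cond_false] <;> infer_instance
  have htoReal {x : ℝ} (hx : x ∈ Set.Icc (0 : ℝ) 1) (b : Bool) :
      (ENNReal.ofReal (bif b then x else 1 - x)).toReal = bif b then x else 1 - x :=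
    ENNReal.toReal_ofReal (by cases b <;> simp [hx.1, hx.2])
  rw [pointLaw_eq_sum_bool, pointLaw_eq_sum_bool,
    integral_pi_sum_smul (fun _ => ENNReal.ofReal_ne_top) _ hG hC,
    integral_pi_sum_smul (fun _ => ENNReal.ofReal_ne_top) _ hG hC, ← Finset.sum_sub_distrib]
  simp only [htoReal hp, htoReal hq, ← sub_mul]
  refine (Finset.abs_sum_le_sum_abs _ _).trans ((Finset.sum_le_sum
    (g := fun _ => Fintype.card κ * |p - q| * C) fun k _ => ?_).trans_eq ?_)
  · rw [abs_mul]
    exact mul_le_mul (abs_prod_cond_sub_le hp hq k) (abs_integral_le_of_abs_le hC) (abs_nonneg _)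
      (by positivity)
  · rw [Finset.sum_const, Finset.card_univ, nsmul_eq_mul, Fintype.card_fun, Fintype.card_bool]
    push_cast
    ring

end Mixtures

section FirstOrder

variable {ι κ : Type*}

/-- The value of `f` at the `i`-th point of the graph of `ρ`, centred. -/
noncomputable def centred [DecidableEq ι] (ρ : Equiv.Perm ι) (f : I × I → ℝ) (i : ι)
    (u : ι → I) : ℝ :=
  f (graphPoint ρ u i) - ∫ z, f z ∂pairLaw ρ i

theorem abs_centred_sub_centred_le [DecidableEq ι] (ρ : Equiv.Perm ι) {f f' : I × I → ℝ}
    {C δ : ℝ} (hf : Measurable f) (hC : ∀ z, |f z| ≤ C) (hf' : Measurable f')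
    (hC' : ∀ z, |f' z| ≤ C) (hδ : ∀ z, |f z - f' z| ≤ δ) (i : ι) (u : ι → I) :
    |centred ρ f i u - centred ρ f' i u| ≤ 2 * δ := by
  have hmean : |∫ z, f z ∂pairLaw ρ i - ∫ z, f' z ∂pairLaw ρ i| ≤ δ := by
    rw [← integral_sub (integrable_of_abs_le hf hC) (integrable_of_abs_le hf' hC')]
    exact abs_integral_le_of_abs_le hδ
  rw [centred, centred, sub_sub_sub_comm]
  exact (abs_sub _ _).trans (by linarith [hδ (graphPoint ρ u i)])

variable [Fintype ι] [Fintype κ] [DecidableEq κ]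

theorem card_mul_sum_apply_eq (a : κ) (L : ι → (κ → ι) → ℝ)
    (hL : ∀ i k j, L i (Function.update k a j) = L i k) :
    Fintype.card ι * ∑ k : κ → ι, L (k a) k = ∑ i, ∑ k : κ → ι, L i k := by
  rw [← nsmul_eq_mul, ← Finset.card_univ, ← Finset.sum_const, ← Finset.sum_product',
    ← Finset.sum_product', Finset.univ_product_univ]
  refine Finset.sum_bij' (fun p _ => (p.2 a, Function.update p.2 a p.1))
    (fun p _ => (p.2 a, Function.update p.2 a p.1)) (fun _ _ => Finset.mem_univ _)
    (fun _ _ => Finset.mem_univ _) ?_ ?_ ?_ <;> rintro ⟨i, k⟩ - <;> simp [hL]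

variable [DecidableEq ι]

/-- The proportion of fixed points of `ρ`. -/
noncomputable def fixFrac (ρ : Equiv.Perm ι) : ℝ :=
  ((Finset.univ.filter fun i => ρ i = i).card : ℝ) / Fintype.card ι

theorem fixFrac_mem_Icc (ρ : Equiv.Perm ι) : fixFrac ρ ∈ Set.Icc (0 : ℝ) 1 := by
  refine ⟨by unfold fixFrac; positivity, div_le_one_of_le₀ ?_ (by positivity)⟩
  exact_mod_cast Finset.card_le_univ _

variable (ρ : Equiv.Perm ι) {g : (κ → I × I) → ℝ} {C : ℝ}

theorem abs_sum_centred_hoeffdingProj_sub_le {p q : ℝ} (hp : p ∈ Set.Icc (0 : ℝ) 1)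
    (hq : q ∈ Set.Icc (0 : ℝ) 1) (hg : Measurable g) (hC : ∀ y, |g y| ≤ C) (u : ι → I) :
    |∑ a, ∑ i, centred ρ (hoeffdingProj (fun _ => pointLaw p) g a) i u -
      ∑ a, ∑ i, centred ρ (hoeffdingProj (fun _ => pointLaw q) g a) i u| ≤
      Fintype.card κ * (Fintype.card ι *
        (2 * (2 ^ Fintype.card κ * (Fintype.card κ * C) * |p - q|))) := by
  have := isProbabilityMeasure_pointLaw hp
  have := isProbabilityMeasure_pointLaw hq
  have hproj (a : κ) (z : I × I) : |hoeffdingProj (fun _ => pointLaw p) g a z -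
      hoeffdingProj (fun _ => pointLaw q) g a z| ≤
      2 ^ Fintype.card κ * (Fintype.card κ * C) * |p - q| :=
    abs_integral_pi_pointLaw_sub_le hp hq
      (hg.comp (by fun_prop : Measurable fun y : κ → I × I => Function.update y a z)) fun _ => hC _
  rw [← nsmul_eq_mul, ← nsmul_eq_mul, ← Finset.card_univ, ← Finset.card_univ, ← Finset.sum_const,
    ← Finset.sum_const, ← Finset.sum_sub_distrib]
  refine (Finset.abs_sum_le_sum_abs _ _).trans (Finset.sum_le_sum fun a _ => ?_)
  rw [← Finset.sum_sub_distrib]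
  exact (Finset.abs_sum_le_sum_abs _ _).trans (Finset.sum_le_sum fun i _ =>
    abs_centred_sub_centred_le ρ (measurable_hoeffdingProj _ hg a) (abs_hoeffdingProj_le _ hC a)
      (measurable_hoeffdingProj _ hg a) (abs_hoeffdingProj_le _ hC a) (hproj a) i u)

variable [Nonempty ι]

theorem sum_integral_pi_pairLaw (hg : Measurable g) (hC : ∀ y, |g y| ≤ C) :
    ∑ k : κ → ι, ∫ y, g y ∂Measure.pi (fun a => pairLaw ρ (k a)) =
      (Fintype.card ι : ℝ) ^ Fintype.card κ *
        ∫ y, g y ∂Measure.pi (fun _ => pointLaw (fixFrac ρ)) := by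
  have hcard : (Fintype.card ι : ℝ) ≠ 0 := Nat.cast_ne_zero.2 Fintype.card_ne_zero
  rw [fixFrac, pointLaw_eq_sum_pairLaw ρ, integral_pi_sum_smul
    (fun _ => ENNReal.inv_ne_top.2 (Nat.cast_ne_zero.2 Fintype.card_ne_zero)) _ hg hC]
  simp only [ENNReal.toReal_inv, ENNReal.toReal_natCast, Finset.prod_const, Finset.card_univ]
  rw [← Finset.mul_sum, ← mul_assoc, ← mul_pow, mul_inv_cancel₀ hcard, one_pow, one_mul]

theorem sum_hoeffdingProj_pairLaw (hg : Measurable g) (hC : ∀ y, |g y| ≤ C) (a : κ) (z : I × I) :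
    ∑ k : κ → ι, hoeffdingProj (fun b => pairLaw ρ (k b)) g a z =
      (Fintype.card ι : ℝ) ^ Fintype.card κ *
        hoeffdingProj (fun _ => pointLaw (fixFrac ρ)) g a z :=
  sum_integral_pi_pairLaw ρ
    (hg.comp (by fun_prop : Measurable fun y : κ → I × I => Function.update y a z)) fun _ => hC _

theorem sum_centred_hoeffdingProj_pairLaw (hg : Measurable g) (hC : ∀ y, |g y| ≤ C) (a : κ)
    (u : ι → I) :
    ∑ k : κ → ι, centred ρ (hoeffdingProj (fun b => pairLaw ρ (k b)) g a) (k a) u =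
      (Fintype.card ι : ℝ) ^ Fintype.card κ / Fintype.card ι *
        ∑ i, centred ρ (hoeffdingProj (fun _ => pointLaw (fixFrac ρ)) g a) i u := by
  have hcard : (Fintype.card ι : ℝ) ≠ 0 := Nat.cast_ne_zero.2 Fintype.card_ne_zero
  have hupdate (k : κ → ι) (j : ι) :
      hoeffdingProj (fun b => pairLaw ρ (Function.update k a j b)) g a =
        hoeffdingProj (fun b => pairLaw ρ (k b)) g a := by
    rw [← hoeffdingProj_update (fun b => pairLaw ρ (k b)) hg a (pairLaw ρ j)]
    congr 1
    ext1 b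
    exact Function.apply_update (fun _ => pairLaw ρ) k a j b
  have hreindex := card_mul_sum_apply_eq a
    (fun i k => centred ρ (hoeffdingProj (fun b => pairLaw ρ (k b)) g a) i u)
    (fun i k j => by rw [hupdate])
  rw [div_mul_eq_mul_div, eq_div_iff hcard, mul_comm, hreindex, Finset.mul_sum]
  refine Finset.sum_congr rfl fun i _ => ?_
  simp only [centred]
  rw [Finset.sum_sub_distrib, sum_hoeffdingProj_pairLaw ρ hg hC, mul_sub, ← integral_const_mul]
  simp only [← sum_hoeffdingProj_pairLaw ρ hg hC]
  rw [integral_finsetSum _ fun k _ =>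
    integrable_of_abs_le (measurable_hoeffdingProj _ hg a) (abs_hoeffdingProj_le _ hC a)]

theorem sum_graphPoint_eq (hg : Measurable g) (hC : ∀ y, |g y| ≤ C) (u : ι → I) :
    ∑ k : κ → ι, g (fun a => graphPoint ρ u (k a)) =
      ∑ k : κ → ι, graphRem ρ g k u +
        (Fintype.card ι : ℝ) ^ Fintype.card κ *
          ∫ y, g y ∂Measure.pi (fun _ => pointLaw (fixFrac ρ)) +
        (Fintype.card ι : ℝ) ^ Fintype.card κ / Fintype.card ι *
          ∑ a, ∑ i, centred ρ (hoeffdingProj (fun _ => pointLaw (fixFrac ρ)) g a) i u := by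
  rw [Finset.mul_sum, ← sum_integral_pi_pairLaw ρ hg hC]
  simp only [← sum_centred_hoeffdingProj_pairLaw ρ hg hC]
  rw [Finset.sum_comm, ← Finset.sum_add_distrib, ← Finset.sum_add_distrib]
  refine Finset.sum_congr rfl fun k _ => ?_
  simp only [graphRem, hoeffdingRem, centred,
    integral_hoeffdingProj (fun b => pairLaw ρ (k b)) hg hC]
  ring

theorem abs_sum_graphPoint_sub_le {p : ℝ} (hp : p ∈ Set.Icc (0 : ℝ) 1) (hg : Measurable g)
    (hC : ∀ y, |g y| ≤ C) (u : ι → I) :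
    |∑ k : κ → ι, g (fun a => graphPoint ρ u (k a)) - ∑ k : κ → ι, graphRem ρ g k u -
      (Fintype.card ι : ℝ) ^ Fintype.card κ * ∫ y, g y ∂Measure.pi (fun _ => pointLaw p) -
      (Fintype.card ι : ℝ) ^ Fintype.card κ / Fintype.card ι *
        ∑ a, ∑ i, centred ρ (hoeffdingProj (fun _ => pointLaw p) g a) i u| ≤
      (Fintype.card ι : ℝ) ^ Fintype.card κ * ((1 + 2 * Fintype.card κ) *
        (2 ^ Fintype.card κ * (Fintype.card κ * C)) * |fixFrac ρ - p|) := by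
  have hcard : (0 : ℝ) < Fintype.card ι := Nat.cast_pos.2 Fintype.card_pos
  have hmean := abs_integral_pi_pointLaw_sub_le (fixFrac_mem_Icc ρ) hp hg hC
  have hlin := abs_sum_centred_hoeffdingProj_sub_le ρ (fixFrac_mem_Icc ρ) hp hg hC u
  rw [sum_graphPoint_eq ρ hg hC u]
  set A := ∑ a, ∑ i, centred ρ (hoeffdingProj (fun _ => pointLaw (fixFrac ρ)) g a) i u
  set B := ∑ a, ∑ i, centred ρ (hoeffdingProj (fun _ => pointLaw p) g a) i u
  set M := ∫ y, g y ∂Measure.pi (fun _ => pointLaw (fixFrac ρ))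
  set N := ∫ y, g y ∂Measure.pi (fun _ => pointLaw p)
  set δ := 2 ^ Fintype.card κ * (Fintype.card κ * C) * |fixFrac ρ - p| with hδ
  have hlin' : |(A - B) / Fintype.card ι| ≤ 2 * Fintype.card κ * δ := by
    rw [abs_div, Nat.abs_cast, div_le_iff₀ hcard]
    linarith
  calc _ = |(Fintype.card ι : ℝ) ^ Fintype.card κ * ((M - N) + (A - B) / Fintype.card ι)| := by
        congr 1
        field_simp
        ring
    _ = (Fintype.card ι : ℝ) ^ Fintype.card κ * |(M - N) + (A - B) / Fintype.card ι| := by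
        rw [abs_mul, abs_of_nonneg (by positivity)]
    _ ≤ (Fintype.card ι : ℝ) ^ Fintype.card κ * (δ + 2 * Fintype.card κ * δ) := by
        gcongr
        exact (abs_add_le _ _).trans (add_le_add hmean hlin')
    _ = _ := by rw [hδ]; ring

end FirstOrder

section SteinTikhomirov

theorem norm_cexp_mul_I_sub_one_sub_le (x : ℝ) :
    ‖Complex.exp (x * Complex.I) - 1 - x * Complex.I‖ ≤ 3 * x ^ 2 := by
  have hnorm : ‖(x : ℂ) * Complex.I‖ = |x| := by simp
  rcases le_or_gt |x| 1 with h | h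
  · have hsq := Complex.norm_exp_sub_one_sub_id_le (x := x * Complex.I) (by rwa [hnorm])
    rw [hnorm, sq_abs] at hsq
    nlinarith [sq_nonneg x]
  · have hsub := norm_sub_le (Complex.exp (x * Complex.I) - 1) (x * Complex.I)
    have hexp := norm_sub_le (Complex.exp (x * Complex.I)) 1
    rw [Complex.norm_exp_ofReal_mul_I, norm_one] at hexp
    rw [hnorm] at hsub
    nlinarith [sq_abs x]

theorem norm_cexp_sub_cexp_sub_le (s y : ℝ) :
    ‖Complex.exp (s * Complex.I) - Complex.exp ((s - y : ℝ) * Complex.I) -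
      y * Complex.I * Complex.exp (s * Complex.I)‖ ≤ 3 * y ^ 2 := by
  have hexp : Complex.exp ((s - y : ℝ) * Complex.I) =
      Complex.exp (s * Complex.I) * Complex.exp ((-y : ℝ) * Complex.I) := by
    rw [← Complex.exp_add]
    congr 1
    push_cast
    ring
  have hfactor : Complex.exp (s * Complex.I) - Complex.exp ((s - y : ℝ) * Complex.I) -
      y * Complex.I * Complex.exp (s * Complex.I) = -Complex.exp (s * Complex.I) *
        (Complex.exp ((-y : ℝ) * Complex.I) - 1 - (-y : ℝ) * Complex.I) := by
    rw [hexp]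
    push_cast
    ring
  rw [hfactor, norm_mul, norm_neg, Complex.norm_exp_ofReal_mul_I, one_mul, ← neg_sq y]
  exact norm_cexp_mul_I_sub_one_sub_le (-y)

/-- The solution of `Φ' t = -t * v * Φ t`, `Φ 0 = 1` is `exp (-v * t ^ 2 / 2)`. -/
theorem norm_sub_cexp_neg_half_le {Φ Φ' : ℝ → ℂ} {v ε : ℝ} (hv : 0 ≤ v)
    (hΦ : ∀ t, HasDerivAt Φ (Φ' t) t) (hΦ0 : Φ 0 = 1)
    (hε : ∀ t ∈ Set.Icc (0 : ℝ) 1, ‖Φ' t + t * v * Φ t‖ ≤ ε) :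
    ‖Φ 1 - Complex.exp (-(v / 2 : ℝ))‖ ≤ ε := by
  let G (t : ℝ) : ℂ := Complex.exp ((v * t ^ 2 / 2 : ℝ))
  have hG (t : ℝ) : HasDerivAt G (G t * (v * t)) t := by
    have hexponent : HasDerivAt (fun t : ℝ => v * t ^ 2 / 2) (v * t) t :=
      (((hasDerivAt_pow 2 t).const_mul v).div_const 2).congr_deriv (by simp; ring)
    simpa only [Complex.ofReal_mul] using hexponent.ofReal_comp.cexp
  have hnorm (x : ℝ) : ‖Complex.exp (x : ℂ)‖ = Real.exp x := by
    rw [Complex.norm_exp, Complex.ofReal_re]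
  have hsegment := norm_image_sub_le_of_norm_deriv_le_segment_01' (f := fun t => Φ t * G t)
    (f' := fun t => Φ' t * G t + Φ t * (G t * (v * t))) (C := ε * Real.exp (v / 2))
    (fun t _ => ((hΦ t).mul (hG t)).hasDerivWithinAt) (fun t ht => by
      have hode := hε t ⟨ht.1, ht.2.le⟩
      rw [show Φ' t * G t + Φ t * (G t * (v * t)) = (Φ' t + t * v * Φ t) * G t by ring, norm_mul]
      refine mul_le_mul hode ?_ (norm_nonneg _) ((norm_nonneg _).trans hode)
      rw [hnorm, Real.exp_le_exp]
      nlinarith [ht.1, ht.2, mul_nonneg hv (mul_nonneg (sub_nonneg.2 ht.2.le) (by linarith [ht.1] :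
        (0 : ℝ) ≤ 1 + t))])
  have hfactor : Φ 1 - Complex.exp (-(v / 2 : ℝ)) =
      (Φ 1 * G 1 - Φ 0 * G 0) * Complex.exp ((-(v / 2) : ℝ)) := by
    simp only [G, hΦ0]
    rw [sub_mul, mul_assoc, ← Complex.exp_add]
    simp
  rw [hfactor, norm_mul, hnorm]
  refine (mul_le_mul_of_nonneg_right hsegment (Real.exp_pos _).le).trans_eq ?_
  rw [mul_assoc, ← Real.exp_add, add_neg_cancel, Real.exp_zero, mul_one]

theorem integral_mul_cexp_eq_zero {Ω : Type*} [MeasurableSpace Ω] {μ : Measure Ω} {X T : Ω → ℝ}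
    (hX : Measurable X) (hT : Measurable T)
    (hX0 : ∫ ω, X ω ∂μ = 0) (hXT : IndepFun X T μ) :
    ∫ ω, X ω * Complex.I * Complex.exp (T ω * Complex.I) ∂μ = 0 := by
  have hindep : IndepFun (fun ω => X ω * Complex.I) (fun ω => Complex.exp (T ω * Complex.I)) μ :=
    hXT.comp (by fun_prop : Measurable fun x : ℝ => (x : ℂ) * Complex.I)
      (by fun_prop : Measurable fun x : ℝ => Complex.exp (x * Complex.I))
  rw [hindep.integral_fun_mul_eq_mul_integral (by fun_prop) (by fun_prop), integral_mul_const,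
    integral_complex_ofReal, hX0]
  simp

theorem abs_sum_le_mul_of_card_le {ι : Type*} {b D : ℝ} (hb0 : 0 ≤ b) {x : ι → ℝ}
    (hx : ∀ i, |x i| ≤ b) {s : Finset ι} (hs : (s.card : ℝ) ≤ D) : |∑ i ∈ s, x i| ≤ D * b :=
  (Finset.abs_sum_le_sum_abs _ _).trans <| (Finset.sum_le_card_nsmul _ _ b fun i _ => hx i).trans
    (by rw [nsmul_eq_mul]; exact mul_le_mul_of_nonneg_right hs hb0)

variable {Ω : Type*} [MeasurableSpace Ω] {μ : Measure Ω} [IsProbabilityMeasure μ]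

theorem integrable_mul_cexp {f : Ω → ℂ} {S : Ω → ℝ} {C : ℝ} (hf : Measurable f)
    (hC : ∀ ω, ‖f ω‖ ≤ C) (hS : Measurable S) :
    Integrable (fun ω => f ω * Complex.exp (S ω * Complex.I)) μ :=
  .of_bound (by fun_prop : Measurable _).aestronglyMeasurable C (ae_of_all _ fun ω => by
    rw [norm_mul, Complex.norm_exp_ofReal_mul_I, mul_one]
    exact hC ω)

theorem hasDerivAt_integral_cexp {S : Ω → ℝ} {C : ℝ} (hS : Measurable S) (hC : ∀ ω, |S ω| ≤ C)
    (t : ℝ) :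
    HasDerivAt (fun t : ℝ => ∫ ω, Complex.exp ((t * S ω : ℝ) * Complex.I) ∂μ)
      (∫ ω, S ω * Complex.I * Complex.exp ((t * S ω : ℝ) * Complex.I) ∂μ) t := by
  refine (hasDerivAt_integral_of_dominated_loc_of_deriv_le (μ := μ)
    (F := fun t ω => Complex.exp ((t * S ω : ℝ) * Complex.I))
    (F' := fun t ω => S ω * Complex.I * Complex.exp ((t * S ω : ℝ) * Complex.I))
    (bound := fun _ => C) (s := Set.univ) univ_mem ?_ ?_ ?_ ?_ (integrable_const _) ?_).2
  · exact .of_forall fun t => (by fun_prop : Measurable _).aestronglyMeasurable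
  · simpa only [one_mul] using integrable_mul_cexp (f := fun _ => 1) (C := 1) (by fun_prop)
      (by simp) (hS.const_mul t)
  · exact (by fun_prop : Measurable _).aestronglyMeasurable
  · refine ae_of_all _ fun ω t _ => ?_
    simpa only [norm_mul, Complex.norm_exp_ofReal_mul_I, Complex.norm_I, Complex.norm_real, mul_one,
      Real.norm_eq_abs] using hC ω
  · refine ae_of_all _ fun ω t _ => ?_
    have hexponent : HasDerivAt (fun t : ℝ => ((t * S ω : ℝ) : ℂ) * Complex.I)
        (S ω * Complex.I) t := by
      simpa using ((hasDerivAt_id t).mul_const (S ω)).ofReal_comp.mul_const Complex.I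
    simpa only [mul_comm] using hexponent.cexp

theorem norm_integral_mul_cexp_add_le {X Y S : Ω → ℝ} {b K : ℝ} (hX : Measurable X)
    (hY : Measurable Y) (hS : Measurable S) (hb : ∀ ω, |X ω| ≤ b) (hK : ∀ ω, |Y ω| ≤ K)
    (hX0 : ∫ ω, X ω ∂μ = 0) (hind : IndepFun X (fun ω => S ω - Y ω) μ) {t : ℝ}
    (ht : t ∈ Set.Icc (0 : ℝ) 1) :
    ‖∫ ω, X ω * Complex.I * Complex.exp ((t * S ω : ℝ) * Complex.I) ∂μ +
      t * ∫ ω, (X ω * Y ω : ℝ) * Complex.exp ((t * S ω : ℝ) * Complex.I) ∂μ‖ ≤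
      3 * b * K ^ 2 := by
  obtain ⟨ω₀⟩ : Nonempty Ω := nonempty_of_isProbabilityMeasure μ
  have hb0 : 0 ≤ b := (abs_nonneg _).trans (hb ω₀)
  let R (ω : Ω) : ℂ := X ω * Complex.I * (Complex.exp ((t * S ω : ℝ) * Complex.I) -
    Complex.exp ((t * S ω - t * Y ω : ℝ) * Complex.I) -
    (t * Y ω : ℝ) * Complex.I * Complex.exp ((t * S ω : ℝ) * Complex.I))
  have hXI (ω : Ω) : ‖(X ω : ℂ) * Complex.I‖ ≤ b := by simpa using hb ω
  have hXY (ω : Ω) : ‖((X ω * Y ω : ℝ) : ℂ)‖ ≤ b * K := by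
    rw [Complex.norm_real, Real.norm_eq_abs, abs_mul]
    exact mul_le_mul (hb ω) (hK ω) (abs_nonneg _) hb0
  have hR (ω : Ω) : ‖R ω‖ ≤ 3 * b * K ^ 2 := by
    have htY : (t * Y ω) ^ 2 ≤ K ^ 2 := by
      rw [← sq_abs, abs_mul, abs_of_nonneg ht.1]
      exact pow_le_pow_left₀ (mul_nonneg ht.1 (abs_nonneg _))
        ((mul_le_of_le_one_left (abs_nonneg _) ht.2).trans (hK ω)) 2
    rw [norm_mul]
    calc _ ≤ b * (3 * (t * Y ω) ^ 2) :=
          mul_le_mul (hXI ω) (norm_cexp_sub_cexp_sub_le _ _) (norm_nonneg _) hb0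
      _ ≤ 3 * b * K ^ 2 := by nlinarith
  have hindep : IndepFun X (fun ω => t * S ω - t * Y ω) μ := by
    simp only [← mul_sub]
    exact hind.comp measurable_id (measurable_const_mul t)
  have hRm : Measurable R := by fun_prop
  have hdecomp (ω : Ω) : X ω * Complex.I * Complex.exp ((t * S ω : ℝ) * Complex.I) +
      t * ((X ω * Y ω : ℝ) * Complex.exp ((t * S ω : ℝ) * Complex.I)) =
      R ω + X ω * Complex.I * Complex.exp ((t * S ω - t * Y ω : ℝ) * Complex.I) := by
    simp only [R, Complex.ofReal_mul]
    linear_combination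
      (X ω * Y ω * t * Complex.exp (t * S ω * Complex.I) : ℂ) * Complex.I_sq
  rw [← integral_const_mul, ← integral_add (integrable_mul_cexp (by fun_prop) hXI (by fun_prop))
    ((integrable_mul_cexp (by fun_prop) hXY (by fun_prop)).const_mul _)]
  simp only [hdecomp]
  rw [integral_add (.of_bound hRm.aestronglyMeasurable _ (ae_of_all _ hR))
    (integrable_mul_cexp (by fun_prop) hXI (by fun_prop)),
    integral_mul_cexp_eq_zero hX (by fun_prop) hX0 hindep, add_zero]
  simpa using norm_integral_le_of_norm_le_const (μ := μ) (ae_of_all _ hR)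

variable {ι : Type*} [Fintype ι] [DecidableEq ι] {X : ι → Ω → ℝ} {b : ℝ} {N : ι → Finset ι}

theorem integral_sum_sq_eq_integral_sum_mul (hX : ∀ i, Measurable (X i))
    (hb : ∀ i ω, |X i ω| ≤ b) (hX0 : ∀ i, ∫ ω, X i ω ∂μ = 0)
    (hind : ∀ i, IndepFun (X i) (fun ω => ∑ j ∈ (N i)ᶜ, X j ω) μ) :
    ∫ ω, (∑ i, X i ω) ^ 2 ∂μ = ∫ ω, ∑ i, X i ω * ∑ j ∈ N i, X j ω ∂μ := by
  have hint (i : ι) (s : Finset ι) : Integrable (fun ω => X i ω * ∑ j ∈ s, X j ω) μ :=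
    (integrable_finsetSum _ fun j _ => integrable_of_abs_le (hX j) (hb j)).bdd_mul
      (hX i).aestronglyMeasurable (ae_of_all _ (hb i))
  have hfar (i : ι) : ∫ ω, X i ω * ∑ j ∈ (N i)ᶜ, X j ω ∂μ = 0 := by
    rw [(hind i).integral_fun_mul_eq_mul_integral (hX i).aestronglyMeasurable
      (Finset.measurable_sum _ fun j _ => hX j).aestronglyMeasurable, hX0, zero_mul]
  have hsplit (ω : Ω) : (∑ i, X i ω) ^ 2 =
      ∑ i, X i ω * ∑ j ∈ N i, X j ω + ∑ i, X i ω * ∑ j ∈ (N i)ᶜ, X j ω := by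
    rw [← Finset.sum_add_distrib, sq, Finset.sum_mul]
    exact Finset.sum_congr rfl fun i _ => by rw [← mul_add, Finset.sum_add_sum_compl]
  simp only [hsplit]
  rw [integral_add (integrable_finsetSum _ fun i _ => hint i _)
    (integrable_finsetSum _ fun i _ => hint i _), add_eq_left,
    integral_finsetSum _ fun i _ => hint i _]
  exact Finset.sum_eq_zero fun i _ => hfar i

variable {D v δ : ℝ} (hX : ∀ i, Measurable (X i)) (hb : ∀ i ω, |X i ω| ≤ b) (hb0 : 0 ≤ b)
  (hX0 : ∀ i, ∫ ω, X i ω ∂μ = 0) (hN : ∀ i, ((N i).card : ℝ) ≤ D)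
  (hind : ∀ i, IndepFun (X i) (fun ω => ∑ j ∈ (N i)ᶜ, X j ω) μ)
  (hδ : ∫ ω, |∑ i, X i ω * ∑ j ∈ N i, X j ω - v| ∂μ ≤ δ)

include hX hb hb0 hX0 hN hind

theorem norm_integral_sum_mul_cexp_add_le {t : ℝ} (ht : t ∈ Set.Icc (0 : ℝ) 1) :
    ‖∫ ω, (∑ i, X i ω : ℝ) * Complex.I * Complex.exp ((t * ∑ i, X i ω : ℝ) * Complex.I) ∂μ +
      t * ∫ ω, (∑ i, X i ω * ∑ j ∈ N i, X j ω : ℝ) *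
        Complex.exp ((t * ∑ i, X i ω : ℝ) * Complex.I) ∂μ‖ ≤
      3 * Fintype.card ι * D ^ 2 * b ^ 3 := by
  have hY (i : ι) (ω : Ω) : |∑ j ∈ N i, X j ω| ≤ D * b :=
    abs_sum_le_mul_of_card_le hb0 (hb · ω) (hN i)
  have hXI (i : ι) (ω : Ω) : ‖(X i ω : ℂ) * Complex.I‖ ≤ b := by simpa using hb i ω
  have hXY (i : ι) (ω : Ω) : ‖((X i ω * ∑ j ∈ N i, X j ω : ℝ) : ℂ)‖ ≤ b * (D * b) := by
    rw [Complex.norm_real, Real.norm_eq_abs, abs_mul]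
    exact mul_le_mul (hb i ω) (hY i ω) (abs_nonneg _) hb0
  have hterm (i : ι) := norm_integral_mul_cexp_add_le (μ := μ) (hX i)
    (Finset.measurable_sum (N i) fun j _ => hX j)
    (Finset.measurable_sum Finset.univ fun j _ => hX j) (hb i) (hY i) (hX0 i)
    (by simpa only [← Finset.sum_add_sum_compl (N i), add_sub_cancel_left] using hind i) ht
  have hcard : ∑ _i : ι, 3 * b * (D * b) ^ 2 = 3 * Fintype.card ι * D ^ 2 * b ^ 3 := by
    rw [Finset.sum_const, Finset.card_univ, nsmul_eq_mul]
    ring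
  refine le_of_eq_of_le ?_ ((norm_sum_le_of_le _ fun i _ => hterm i).trans_eq hcard)
  rw [Finset.sum_add_distrib, ← Finset.mul_sum, ← integral_finsetSum _ fun i _ =>
    integrable_mul_cexp (by fun_prop) (hXI i) (by fun_prop), ← integral_finsetSum _ fun i _ =>
    integrable_mul_cexp (by fun_prop) (hXY i) (by fun_prop)]
  simp only [← Finset.sum_mul, ← Complex.ofReal_sum]

include hδ

theorem norm_deriv_charFun_add_le {t : ℝ} (ht : t ∈ Set.Icc (0 : ℝ) 1) :
    ‖∫ ω, (∑ i, X i ω : ℝ) * Complex.I * Complex.exp ((t * ∑ i, X i ω : ℝ) * Complex.I) ∂μ +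
      t * v * ∫ ω, Complex.exp ((t * ∑ i, X i ω : ℝ) * Complex.I) ∂μ‖ ≤
      δ + 3 * Fintype.card ι * D ^ 2 * b ^ 3 := by
  set e : Ω → ℂ := fun ω => Complex.exp ((t * ∑ i, X i ω : ℝ) * Complex.I)
  have hQ (ω : Ω) : ‖((∑ i, X i ω * ∑ j ∈ N i, X j ω : ℝ) : ℂ)‖ ≤
      ∑ _i : ι, b * (D * b) := by
    rw [Complex.norm_real]
    refine norm_sum_le_of_le _ fun i _ => ?_
    rw [Real.norm_eq_abs, abs_mul]
    exact mul_le_mul (hb i ω) (abs_sum_le_mul_of_card_le hb0 (hb · ω) (hN i)) (abs_nonneg _) hb0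
  have hmean : ‖∫ ω, (∑ i, X i ω * ∑ j ∈ N i, X j ω : ℝ) * e ω ∂μ - v * ∫ ω, e ω ∂μ‖ ≤ δ := by
    rw [← integral_const_mul, ← integral_sub
      (integrable_mul_cexp (by fun_prop) hQ (by fun_prop))
      (integrable_mul_cexp (C := ‖(v : ℂ)‖) (by fun_prop) (fun _ => le_rfl) (by fun_prop))]
    refine (norm_integral_le_integral_norm _).trans (le_of_eq_of_le ?_ hδ)
    refine integral_congr_ae (ae_of_all _ fun ω => ?_)
    beta_reduce
    rw [← sub_mul, norm_mul, Complex.norm_exp_ofReal_mul_I, mul_one, ← Complex.ofReal_sub,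
      Complex.norm_real, Real.norm_eq_abs]
  have hstein := norm_integral_sum_mul_cexp_add_le hX hb hb0 hX0 hN hind ht
  have ht1 : ‖(t : ℂ)‖ ≤ 1 := by simpa [abs_of_nonneg ht.1] using ht.2
  set A := ∫ ω, (∑ i, X i ω : ℝ) * Complex.I * e ω ∂μ
  set B := ∫ ω, (∑ i, X i ω * ∑ j ∈ N i, X j ω : ℝ) * e ω ∂μ
  calc ‖A + t * v * ∫ ω, e ω ∂μ‖ = ‖(A + t * B) - t * (B - v * ∫ ω, e ω ∂μ)‖ := by
        congr 1
        ring
    _ ≤ ‖A + t * B‖ + ‖t * (B - v * ∫ ω, e ω ∂μ)‖ := norm_sub_le _ _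
    _ ≤ 3 * Fintype.card ι * D ^ 2 * b ^ 3 + δ := by
        gcongr
        rw [norm_mul]
        exact (mul_le_of_le_one_left (norm_nonneg _) ht1).trans hmean
    _ = _ := add_comm _ _

theorem norm_integral_cexp_sub_le (hv : 0 ≤ v) :
    ‖∫ ω, Complex.exp ((∑ i, X i ω : ℝ) * Complex.I) ∂μ - Complex.exp (-(v / 2 : ℝ))‖ ≤
      δ + 3 * Fintype.card ι * D ^ 2 * b ^ 3 := by
  have hderiv := hasDerivAt_integral_cexp (μ := μ)
    (Finset.measurable_sum Finset.univ fun i _ => hX i)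
    fun ω => abs_sum_le_mul_of_card_le hb0 (hb · ω) le_rfl
  simpa using norm_sub_cexp_neg_half_le hv hderiv (by simp)
    fun t => norm_deriv_charFun_add_le hX hb hb0 hX0 hN hind hδ

end SteinTikhomirov

section LinearStatistic

variable {ι : Type*} [DecidableEq ι] {ρ : Equiv.Perm ι} {f : I × I → ℝ} {C : ℝ}

theorem measurable_centred (hf : Measurable f) (i : ι) : Measurable (centred ρ f i) :=
  (hf.comp (measurable_graphPoint ρ i)).sub_const _

theorem abs_centred_le (hC : ∀ z, |f z| ≤ C) (i : ι) (u : ι → I) : |centred ρ f i u| ≤ 2 * C :=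
  (abs_sub _ _).trans (by
    linarith [hC (graphPoint ρ u i), abs_integral_le_of_abs_le (μ := pairLaw ρ i) hC])

theorem dependsOn_centred (i : ι) :
    DependsOn (centred ρ f i) (({i, ρ i} : Finset ι) : Set ι) := fun _ _ h =>
  congrArg (f · - _) (dependsOn_graphPoint ρ i h)

variable [Fintype ι]

/-- The indices near `i`: their points may depend on the `i`-th one. -/
def nbhd (ρ : Equiv.Perm ι) (i : ι) : Finset ι := Finset.univ.filter (Near ρ i)

/-- The coordinates used by the points whose indices are near `i`. -/
def nbhdCoords (ρ : Equiv.Perm ι) (i : ι) : Finset ι := (nbhd ρ i).biUnion fun j => {j, ρ j}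

/-- The product of the `i`-th centred value of `f` with the sum of those near it. -/
noncomputable def localProd (ρ : Equiv.Perm ι) (f : I × I → ℝ) (i : ι) (u : ι → I) : ℝ :=
  centred ρ f i u * ∑ j ∈ nbhd ρ i, centred ρ f j u

/-- The variance of the normalized linear statistic `(card ι)^(-1/2) * ∑ i, centred ρ f i`. -/
noncomputable def linearVariance (ρ : Equiv.Perm ι) (f : I × I → ℝ) : ℝ :=
  (Fintype.card ι : ℝ)⁻¹ * ∫ u : ι → I, (∑ i, centred ρ f i u) ^ 2

theorem linearVariance_nonneg : 0 ≤ linearVariance ρ f :=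
  mul_nonneg (by positivity) (integral_nonneg fun _ => sq_nonneg _)

theorem nbhd_eq (ρ : Equiv.Perm ι) (i : ι) : nbhd ρ i = {i, ρ i, ρ⁻¹ i} := by
  ext j
  simp [nbhd, Near, Equiv.eq_symm_apply, eq_comm]

theorem card_nbhd_le (i : ι) : (nbhd ρ i).card ≤ 3 :=
  nbhd_eq ρ i ▸ Finset.card_le_three

theorem integral_comp_graphPoint (hf : Measurable f) (i : ι) :
    ∫ u : ι → I, f (graphPoint ρ u i) = ∫ z, f z ∂pairLaw ρ i := by
  rw [← map_graphPoint, integral_map (measurable_graphPoint ρ i).aemeasurable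
    hf.aestronglyMeasurable]

theorem integral_centred (hf : Measurable f) (hC : ∀ z, |f z| ≤ C) (i : ι) :
    ∫ u : ι → I, centred ρ f i u = 0 := by
  have hint : Integrable (fun u : ι → I => f (graphPoint ρ u i)) :=
    integrable_of_abs_le (hf.comp (measurable_graphPoint ρ i)) fun u => hC _
  simp only [centred]
  rw [integral_sub hint (integrable_const _), integral_comp_graphPoint hf]
  simp

theorem indepFun_centred_sum (hf : Measurable f) (i : ι) :
    IndepFun (centred ρ f i) (fun u => ∑ j ∈ (nbhd ρ i)ᶜ, centred ρ f j u)
      (volume : Measure (ι → I)) := by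
  refine indepFun_of_dependsOn _ (measurable_centred hf i)
    (Finset.measurable_sum _ fun j _ => measurable_centred hf j) (dependsOn_centred i)
    (B := ((nbhd ρ i)ᶜ).biUnion fun j => {j, ρ j}) (fun x y h => ?_) ?_
  · exact Finset.sum_congr rfl fun j hj => dependsOn_centred j fun l hl =>
      h l (Finset.mem_biUnion.2 ⟨j, hj, hl⟩)
  · rw [Finset.disjoint_biUnion_right]
    exact fun j hj => disjoint_of_not_near (by simpa [nbhd] using hj)

theorem measurable_localProd (hf : Measurable f) (i : ι) : Measurable (localProd ρ f i) :=
  (measurable_centred hf i).mul (Finset.measurable_sum _ fun j _ => measurable_centred hf j)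

theorem abs_localProd_le (hC : ∀ z, |f z| ≤ C) (i : ι) (u : ι → I) :
    |localProd ρ f i u| ≤ 12 * C ^ 2 := by
  have hC0 : 0 ≤ C := (abs_nonneg _).trans (hC 0)
  have hsum : |∑ j ∈ nbhd ρ i, centred ρ f j u| ≤ 3 * (2 * C) :=
    abs_sum_le_mul_of_card_le (by positivity) (abs_centred_le hC · u)
      (by exact_mod_cast card_nbhd_le i)
  rw [localProd, abs_mul]
  exact (mul_le_mul (abs_centred_le hC i u) hsum (abs_nonneg _) (by positivity)).trans_eq (by ring)

theorem dependsOn_localProd (i : ι) : DependsOn (localProd ρ f i) (nbhdCoords ρ i) := by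
  intro x y h
  have hcentred : ∀ j ∈ nbhd ρ i, centred ρ f j x = centred ρ f j y := fun j hj =>
    dependsOn_centred j fun l hl => h l (Finset.mem_biUnion.2 ⟨j, hj, hl⟩)
  rw [localProd, localProd, Finset.sum_congr rfl hcentred,
    hcentred i (Finset.mem_filter.2 ⟨Finset.mem_univ _, Near.refl ρ i⟩)]

theorem integral_localProd (hf : Measurable f) (hC : ∀ z, |f z| ≤ C) (i : ι) :
    ∫ u, localProd ρ f i u =
      ∑ j ∈ nbhd ρ i, ∫ u : ι → I, centred ρ f i u * centred ρ f j u := by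
  simp only [localProd, Finset.mul_sum]
  exact integral_finsetSum _ fun j _ => integrable_of_abs_le
    ((measurable_centred hf i).mul (measurable_centred hf j)) fun u =>
      abs_mul_le_sq (abs_centred_le hC i u) (abs_centred_le hC j u)

theorem integral_sum_centred_sq (hf : Measurable f) (hC : ∀ z, |f z| ≤ C) :
    ∫ u : ι → I, (∑ i, centred ρ f i u) ^ 2 = ∑ i, ∫ u, localProd ρ f i u := by
  rw [integral_sum_sq_eq_integral_sum_mul (measurable_centred hf) (abs_centred_le hC)
    (integral_centred hf hC) (indepFun_centred_sum hf)]
  exact integral_finsetSum _ fun i _ =>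
    integrable_of_abs_le (measurable_localProd hf i) (abs_localProd_le hC i)

theorem card_not_disjoint_nbhdCoords_le :
    (Finset.univ.filter fun p : ι × ι =>
      ¬ Disjoint (nbhdCoords ρ p.1) (nbhdCoords ρ p.2)).card ≤ 27 * Fintype.card ι := by
  have hsub : (Finset.univ.filter fun p : ι × ι =>
      ¬ Disjoint (nbhdCoords ρ p.1) (nbhdCoords ρ p.2)) ⊆
      (Finset.univ : Finset ((Fin 3 × Fin 3 × Fin 3) × ι)).image fun q =>
        (q.2, cycleStep ρ q.1.1 (cycleStep ρ q.1.2.1 (cycleStep ρ q.1.2.2 q.2))) := by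
    rintro ⟨i, j⟩ hij
    have hmeet := (Finset.mem_filter.1 hij).2
    simp only [nbhdCoords, Finset.disjoint_biUnion_left, Finset.disjoint_biUnion_right] at hmeet
    push Not at hmeet
    obtain ⟨j', hj', i', hi', hmeet⟩ := hmeet
    simp only [nbhd, Finset.mem_filter, Finset.mem_univ, true_and] at hi' hj'
    obtain ⟨a, ha⟩ := near_iff_exists_cycleStep.1 hi'
    obtain ⟨b, hb⟩ := near_iff_exists_cycleStep.1 (not_imp_comm.1 disjoint_of_not_near hmeet)
    obtain ⟨c, hc⟩ := near_iff_exists_cycleStep.1 hj'.symm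
    exact Finset.mem_image.2 ⟨((c, b, a), i), Finset.mem_univ _, by rw [hc, hb, ha]⟩
  refine (Finset.card_le_card hsub).trans (Finset.card_image_le.trans ?_)
  simp

theorem integral_sum_localProd_sub_sq_le (hf : Measurable f) (hC : ∀ z, |f z| ≤ C) :
    ∫ u : ι → I, (∑ i, (localProd ρ f i u - ∫ u', localProd ρ f i u')) ^ 2 ≤
      27 * Fintype.card ι * (24 * C ^ 2) ^ 2 := by
  let W (i : ι) (u : ι → I) : ℝ := localProd ρ f i u - ∫ u', localProd ρ f i u'
  have hWm (i : ι) : Measurable (W i) := (measurable_localProd hf i).sub_const _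
  have hWb (i : ι) (u : ι → I) : |W i u| ≤ 24 * C ^ 2 :=
    (abs_sub _ _).trans (by linarith [abs_localProd_le (ρ := ρ) hC i u,
      abs_integral_le_of_abs_le (μ := (volume : Measure (ι → I))) (abs_localProd_le (ρ := ρ) hC i)])
  have hW0 (i : ι) : ∫ u, W i u = 0 := by
    simp only [W]
    rw [integral_sub (integrable_of_abs_le (measurable_localProd hf i) (abs_localProd_le hC i))
      (integrable_const _)]
    simp
  have hWd (i : ι) : DependsOn (W i) (nbhdCoords ρ i) := fun x y h => by
    simp only [W, dependsOn_localProd i h]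
  refine (integral_sum_sq_le_of_integral_mul_eq_zero hWm hWb
    (R := fun p => ¬ Disjoint (nbhdCoords ρ p.1) (nbhdCoords ρ p.2)) fun p hp => ?_).trans
    (mul_le_mul_of_nonneg_right ?_ (sq_nonneg _))
  · have hind : IndepFun (W p.1) (W p.2) (volume : Measure (ι → I)) :=
      indepFun_of_dependsOn _ (hWm _) (hWm _) (hWd _) (hWd _) (not_not.1 hp)
    rw [hind.integral_fun_mul_eq_mul_integral (hWm _).aestronglyMeasurable
      (hWm _).aestronglyMeasurable, hW0, zero_mul]
  · exact_mod_cast card_not_disjoint_nbhdCoords_le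

theorem integral_abs_sum_localProd_sub_le (hf : Measurable f) (hC : ∀ z, |f z| ≤ C) :
    ∫ u : ι → I, |∑ i, localProd ρ f i u - ∑ i, ∫ u', localProd ρ f i u'| ≤
      √(27 * Fintype.card ι) * (24 * C ^ 2) := by
  have hsqrt : √(27 * Fintype.card ι) * (24 * C ^ 2) =
      √(27 * Fintype.card ι * (24 * C ^ 2) ^ 2) := by
    rw [Real.sqrt_mul' _ (sq_nonneg _), Real.sqrt_sq (by positivity)]
  rw [hsqrt]
  refine integral_abs_le_sqrt
    ((Finset.measurable_sum _ fun i _ => measurable_localProd hf i).sub_const _)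
    (C := ∑ _i : ι, 12 * C ^ 2 + ∑ _i : ι, 12 * C ^ 2) (fun u => ?_)
    (by simpa only [Finset.sum_sub_distrib] using integral_sum_localProd_sub_sq_le hf hC)
  exact (abs_sub _ _).trans (add_le_add
    ((Finset.abs_sum_le_sum_abs _ _).trans (Finset.sum_le_sum fun i _ => abs_localProd_le hC i u))
    ((Finset.abs_sum_le_sum_abs _ _).trans (Finset.sum_le_sum fun i _ =>
      abs_integral_le_of_abs_le (abs_localProd_le hC i))))

variable [Nonempty ι]

theorem integral_abs_scaled_localProd_sub_linearVariance_le (hf : Measurable f)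
    (hC : ∀ z, |f z| ≤ C) :
    ∫ u, |∑ i, (√(Fintype.card ι))⁻¹ * centred ρ f i u *
        ∑ j ∈ nbhd ρ i, (√(Fintype.card ι))⁻¹ * centred ρ f j u - linearVariance ρ f| ≤
      24 * √27 * C ^ 2 * (√(Fintype.card ι))⁻¹ := by
  have hn0 : (0 : ℝ) < Fintype.card ι := Nat.cast_pos.2 Fintype.card_pos
  have hlocal (u : ι → I) : ∑ i, (√(Fintype.card ι))⁻¹ * centred ρ f i u *
        ∑ j ∈ nbhd ρ i, (√(Fintype.card ι))⁻¹ * centred ρ f j u - linearVariance ρ f =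
      (Fintype.card ι : ℝ)⁻¹ * (∑ i, localProd ρ f i u - ∑ i, ∫ u', localProd ρ f i u') := by
    rw [linearVariance, integral_sum_centred_sq hf hC, mul_sub, sub_left_inj, Finset.mul_sum]
    refine Finset.sum_congr rfl fun i _ => ?_
    rw [localProd, ← Finset.mul_sum, mul_mul_mul_comm, ← mul_inv, Real.mul_self_sqrt hn0.le]
  simp only [hlocal, abs_mul, abs_of_pos (inv_pos.2 hn0)]
  rw [integral_const_mul]
  refine (mul_le_mul_of_nonneg_left (integral_abs_sum_localProd_sub_le hf hC)
    (by positivity)).trans_eq ?_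
  rw [Real.sqrt_mul (by norm_num)]
  field_simp
  rw [Real.sq_sqrt hn0.le]

theorem norm_integral_cexp_centred_sub_le (hf : Measurable f) (hC : ∀ z, |f z| ≤ C) :
    ‖(∫ u : ι → I, Complex.exp (((√(Fintype.card ι))⁻¹ * ∑ i, centred ρ f i u : ℝ) * Complex.I)) -
      Complex.exp (-(linearVariance ρ f / 2 : ℝ))‖ ≤
      (24 * √27 * C ^ 2 + 216 * C ^ 3) * (√(Fintype.card ι))⁻¹ := by
  have hC0 : 0 ≤ C := (abs_nonneg _).trans (hC 0)
  have hn0 : (0 : ℝ) < Fintype.card ι := Nat.cast_pos.2 Fintype.card_pos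
  set s := (√(Fintype.card ι))⁻¹ with hs
  have hs0 : 0 < s := by positivity
  have hs2 : Fintype.card ι * s ^ 2 = 1 := by
    rw [hs, inv_pow, Real.sq_sqrt hn0.le, mul_inv_cancel₀ hn0.ne']
  have hbound (i : ι) (u : ι → I) : |s * centred ρ f i u| ≤ s * (2 * C) := by
    rw [abs_mul, abs_of_pos hs0]
    exact mul_le_mul_of_nonneg_left (abs_centred_le hC i u) hs0.le
  have hmean (i : ι) : ∫ u, s * centred ρ f i u = 0 := by
    rw [integral_const_mul, integral_centred hf hC, mul_zero]
  have hind (i : ι) : IndepFun (fun u => s * centred ρ f i u)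
      (fun u => ∑ j ∈ (nbhd ρ i)ᶜ, s * centred ρ f j u) (volume : Measure (ι → I)) := by
    simp only [← Finset.mul_sum]
    exact (indepFun_centred_sum hf i).comp (measurable_const_mul s) (measurable_const_mul s)
  have hstein := norm_integral_cexp_sub_le (fun i => (measurable_centred hf i).const_mul s) hbound
    (by positivity) hmean (D := 3) (fun i => by exact_mod_cast card_nbhd_le i) hind
    (integral_abs_scaled_localProd_sub_linearVariance_le hf hC) linearVariance_nonneg
  simp only [← Finset.mul_sum] at hstein
  refine hstein.trans_eq ?_
  linear_combination (216 * C ^ 3 * s) * hs2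

end LinearStatistic

section LimitVariance

theorem covariance_comp_measurePreserving {Ω E : Type*} [MeasurableSpace Ω] [MeasurableSpace E]
    {μ : Measure Ω} {ν : Measure E} {Z : Ω → E} (hZ : MeasurePreserving Z μ ν) {X Y : E → ℝ}
    (hX : Measurable X) (hY : Measurable Y) :
    cov[fun ω => X (Z ω), fun ω => Y (Z ω); μ] = cov[X, Y; ν] := by
  rw [← hZ.map_eq, covariance_map_fun hX.aestronglyMeasurable hY.aestronglyMeasurable
    hZ.measurable.aemeasurable]

theorem covariance_sum_mul_sum {Ω J : Type*} [MeasurableSpace Ω] {μ : Measure Ω}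
    [IsProbabilityMeasure μ] [Fintype J] (θ η : J → ℝ) {X Y : J → Ω → ℝ} {C : ℝ}
    (hX : ∀ j, Measurable (X j)) (hY : ∀ j, Measurable (Y j)) (hXC : ∀ j ω, |X j ω| ≤ C)
    (hYC : ∀ j ω, |Y j ω| ≤ C) :
    cov[fun ω => ∑ j, θ j * X j ω, fun ω => ∑ j, η j * Y j ω; μ] =
      ∑ i, ∑ j, θ i * η j * cov[X i, Y j; μ] := by
  have hmem {f : Ω → ℝ} (hf : Measurable f) (hC : ∀ ω, |f ω| ≤ C) (c : ℝ) :
      MemLp (fun ω => c * f ω) 2 μ :=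
    (MemLp.of_bound hf.aestronglyMeasurable C (ae_of_all _ hC)).const_mul c
  rw [covariance_fun_sum_fun_sum (fun j => hmem (hX j) (hXC j) _) fun j => hmem (hY j) (hYC j) _]
  simp only [covariance_const_mul_left, covariance_const_mul_right]
  exact Finset.sum_congr rfl fun i _ => Finset.sum_congr rfl fun j _ => by ring

/-- The bilinear form of which `limitCov` is the Gram matrix, see `limitCov_apply`. -/
noncomputable def limitForm (p q : ℝ) (f h : I × I → ℝ) : ℝ :=
  p * cov[fun ω : I × I × I => f (ω.1, ω.1), fun ω => h (ω.1, ω.1); volume]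
    + (1 - p) * cov[fun ω : I × I × I => f (ω.1, ω.2.1), fun ω => h (ω.1, ω.2.1); volume]
    + q * cov[fun ω : I × I × I => f (ω.1, ω.2.1), fun ω => h (ω.2.1, ω.1); volume]
    + (1 - p - q) *
      (cov[fun ω : I × I × I => f (ω.1, ω.2.1), fun ω => h (ω.2.1, ω.2.2); volume]
        + cov[fun ω : I × I × I => h (ω.1, ω.2.1), fun ω => f (ω.2.1, ω.2.2); volume])

theorem limitCov_apply {r : ℕ} (p q : ℝ) (π π' : Equiv.Perm (Fin r)) :
    limitCov r p q π π' = limitForm p q (psi p π) (psi p π') / ((r - 1)! : ℝ) ^ 2 :=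
  rfl

theorem limitForm_comm (p q : ℝ) {f h : I × I → ℝ} (hf : Measurable f) (hh : Measurable h) :
    limitForm p q f h = limitForm p q h f := by
  have hswap : MeasurePreserving (fun ω : I × I × I => (ω.2.1, ω.1, ω.2.2)) volume volume := by
    have hpair : MeasurePreserving (fun ω : I × I × I => ((ω.2.1, ω.1), ω.2.2)) volume volume :=
      (Measure.measurePreserving_swap.prod (MeasurePreserving.id _)).comp
        (measurePreserving_prodAssoc volume volume volume).symm
    exact (measurePreserving_prodAssoc volume volume volume).comp hpair
  have htwo : cov[fun ω : I × I × I => f (ω.1, ω.2.1), fun ω => h (ω.2.1, ω.1); volume] =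
      cov[fun ω : I × I × I => h (ω.1, ω.2.1), fun ω => f (ω.2.1, ω.1); volume] := by
    rw [covariance_comm]
    exact (covariance_comp_measurePreserving hswap (X := fun ω => h (ω.1, ω.2.1))
      (Y := fun ω => f (ω.2.1, ω.1)) (by fun_prop) (by fun_prop))
  rw [limitForm, limitForm, htwo,
    covariance_comm (fun ω : I × I × I => f (ω.1, ω.1)),
    covariance_comm (fun ω : I × I × I => f (ω.1, ω.2.1)) (fun ω => h (ω.1, ω.2.1))]
  ring

theorem limitForm_sum_mul {J : Type*} [Fintype J] (p q : ℝ) (θ : J → ℝ) {f : J → I × I → ℝ}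
    {C : ℝ} (hf : ∀ j, Measurable (f j)) (hC : ∀ j z, |f j z| ≤ C) :
    limitForm p q (fun z => ∑ j, θ j * f j z) (fun z => ∑ j, θ j * f j z) =
      ∑ i, ∑ j, θ i * θ j * limitForm p q (f i) (f j) := by
  have hcov (a b : I × I × I → I × I) (ha : Measurable a) (hb : Measurable b) :
      cov[fun ω => ∑ j, θ j * f j (a ω), fun ω => ∑ j, θ j * f j (b ω); volume] =
        ∑ i, ∑ j, θ i * θ j * cov[fun ω => f i (a ω), fun ω => f j (b ω); volume] :=
    covariance_sum_mul_sum θ θ (fun j => (hf j).comp ha) (fun j => (hf j).comp hb)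
      (fun j _ => hC j _) fun j _ => hC j _
  have hcomm : ∑ i, ∑ j, θ i * θ j * cov[fun ω : I × I × I => f j (ω.1, ω.2.1),
      fun ω => f i (ω.2.1, ω.2.2); volume] = ∑ i, ∑ j, θ i * θ j *
        cov[fun ω : I × I × I => f i (ω.1, ω.2.1), fun ω => f j (ω.2.1, ω.2.2); volume] := by
    rw [Finset.sum_comm]
    exact Finset.sum_congr rfl fun i _ => Finset.sum_congr rfl fun j _ => by rw [mul_comm (θ j)]
  simp only [limitForm]
  rw [hcov _ _ (by fun_prop) (by fun_prop), hcov _ _ (by fun_prop) (by fun_prop),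
    hcov _ _ (by fun_prop) (by fun_prop), hcov _ _ (by fun_prop) (by fun_prop)]
  conv_lhs => enter [2, 2, 2]; rw [← hcomm]
  simp only [Finset.mul_sum, ← Finset.sum_add_distrib]
  exact Finset.sum_congr rfl fun i _ => Finset.sum_congr rfl fun j _ => by ring

theorem continuous_limitForm (f h : I × I → ℝ) :
    Continuous fun pq : ℝ × ℝ => limitForm pq.1 pq.2 f h := by
  unfold limitForm
  fun_prop

variable {ι : Type*} [Fintype ι] {ρ : Equiv.Perm ι} {f : I × I → ℝ} {C : ℝ}

theorem covariance_graphPoint_of_apply_eq (hf : Measurable f) {i : ι} (h : ρ i = i) :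
    cov[fun u : ι → I => f (graphPoint ρ u i), fun u => f (graphPoint ρ u i); volume] =
      cov[fun ω : I × I × I => f (ω.1, ω.1), fun ω => f (ω.1, ω.1); volume] := by
  have hdiag : Measurable fun x : I => f (x, x) := by fun_prop
  simp only [graphPoint, h]
  exact (covariance_comp_measurePreserving
    (measurePreserving_eval (fun _ : ι => (volume : Measure I)) i) hdiag hdiag).trans
    (covariance_comp_measurePreserving
      (measurePreserving_fst : MeasurePreserving (fun ω : I × I × I => ω.1) volume volume)
      hdiag hdiag).symm

theorem covariance_apply_apply_eq {g : I × I → ℝ} (hf : Measurable f) (hg : Measurable g) {i j : ι}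
    (hij : i ≠ j) :
    cov[fun u : ι → I => f (u i, u j), fun u => g (u i, u j); volume] =
      cov[fun ω : I × I × I => f (ω.1, ω.2.1), fun ω => g (ω.1, ω.2.1); volume] := by
  have hpair : MeasurePreserving (fun ω : I × I × I => (ω.1, ω.2.1)) volume volume :=
    (MeasurePreserving.id _).prod measurePreserving_fst
  exact (covariance_comp_measurePreserving (Z := fun u : ι → I => (u i, u j))
    ⟨by fun_prop, map_prodMk_apply (fun _ => volume) hij⟩ hf hg).trans
    (covariance_comp_measurePreserving hpair hf hg).symm

theorem covariance_graphPoint_apply (hf : Measurable f) {i : ι} (h : ρ i ≠ i)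
    (h2 : ρ (ρ i) ≠ i) :
    cov[fun u : ι → I => f (graphPoint ρ u i), fun u => f (graphPoint ρ u (ρ i)); volume] =
      cov[fun ω : I × I × I => f (ω.1, ω.2.1), fun ω => f (ω.2.1, ω.2.2); volume] :=
  covariance_comp_measurePreserving (Z := fun u : ι → I => (u i, u (ρ i), u (ρ (ρ i))))
    ⟨by fun_prop, map_prodMk_prodMk_apply (fun _ => volume) h.symm h2.symm fun he =>
      h (ρ.injective he).symm⟩
    (X := fun ω : I × I × I => f (ω.1, ω.2.1)) (Y := fun ω => f (ω.2.1, ω.2.2))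
    (by fun_prop) (by fun_prop)

variable [DecidableEq ι]

theorem integral_centred_mul_centred (hf : Measurable f) (i j : ι) :
    ∫ u : ι → I, centred ρ f i u * centred ρ f j u =
      cov[fun u : ι → I => f (graphPoint ρ u i), fun u => f (graphPoint ρ u j); volume] := by
  rw [covariance, integral_comp_graphPoint hf, integral_comp_graphPoint hf]
  rfl

theorem integral_localProd_eq (hf : Measurable f) (hC : ∀ z, |f z| ≤ C) (i : ι) :
    ∫ u, localProd ρ f i u = limitForm (if ρ i = i then 1 else 0)
      (if ρ i ≠ i ∧ ρ (ρ i) = i then 1 else 0) f f := by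
  rw [integral_localProd hf hC, nbhd_eq]
  simp only [integral_centred_mul_centred hf]
  by_cases h : ρ i = i
  · have hinv : ρ⁻¹ i = i := Equiv.Perm.inv_eq_iff_eq.2 h.symm
    simp [h, hinv, limitForm, covariance_graphPoint_of_apply_eq hf h]
  have hself := covariance_apply_apply_eq hf hf (Ne.symm h)
  by_cases h2 : ρ (ρ i) = i
  · have hinv : ρ⁻¹ i = ρ i := Equiv.Perm.inv_eq_iff_eq.2 h2.symm
    have hswap := covariance_apply_apply_eq hf (hf.comp measurable_swap) (Ne.symm h)
    rw [hinv, Finset.pair_eq_singleton, Finset.sum_pair (Ne.symm h)]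
    simpa [h, h2, limitForm, graphPoint] using congrArg₂ (· + ·) hself hswap
  · have hinv : ρ (ρ⁻¹ i) = i := ρ.apply_symm_apply i
    have hne : i ≠ ρ⁻¹ i := fun he => h (Equiv.Perm.eq_inv_iff_eq.1 he)
    have hne2 : ρ i ≠ ρ⁻¹ i := fun he => h2 (Equiv.Perm.eq_inv_iff_eq.1 he)
    have hnext := covariance_graphPoint_apply hf h h2
    have hprev := covariance_graphPoint_apply (ρ := ρ) hf (i := ρ⁻¹ i) (by rwa [hinv])
      (by rwa [hinv])
    rw [hinv, covariance_comm] at hprev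
    rw [Finset.sum_insert (by
      rw [Finset.mem_insert, Finset.mem_singleton]
      push Not
      exact ⟨Ne.symm h, hne⟩), Finset.sum_pair hne2, hprev, hnext]
    simp [h, h2, limitForm, graphPoint, hself]

/-- The proportion of points of `ρ` that belong to a cycle of length two. -/
noncomputable def twoCycleFrac (ρ : Equiv.Perm ι) : ℝ :=
  ((Finset.univ.filter fun i => ρ i ≠ i ∧ ρ (ρ i) = i).card : ℝ) / Fintype.card ι

theorem linearVariance_eq_limitForm [Nonempty ι] (hf : Measurable f) (hC : ∀ z, |f z| ≤ C) :
    linearVariance ρ f = limitForm (fixFrac ρ) (twoCycleFrac ρ) f f := by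
  have hcard : (Fintype.card ι : ℝ) ≠ 0 := Nat.cast_ne_zero.2 Fintype.card_ne_zero
  rw [linearVariance, integral_sum_centred_sq hf hC, inv_mul_eq_iff_eq_mul₀ hcard]
  simp only [integral_localProd_eq hf hC, limitForm, Finset.sum_add_distrib, ← Finset.sum_mul,
    Finset.sum_sub_distrib, Finset.sum_boole, Finset.sum_const, Finset.card_univ, nsmul_eq_mul,
    fixFrac, twoCycleFrac]
  field_simp

end LimitVariance

section PatternProjection

theorem integral_comp_eq_sum_measureReal {Ω E : Type*} [MeasurableSpace Ω] [MeasurableSpace E]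
    [Fintype E] [DiscreteMeasurableSpace E] {μ : Measure Ω} [IsFiniteMeasure μ] {X : Ω → E}
    (hX : Measurable X) (θ : E → ℝ) :
    ∫ ω, θ (X ω) ∂μ = ∑ x, θ x * μ.real {ω | X ω = x} := by
  rw [← integral_map hX.aemeasurable (Measurable.of_discrete (f := θ)).aestronglyMeasurable,
    integral_fintype .of_finite]
  refine Finset.sum_congr rfl fun x _ => ?_
  rw [map_measureReal_apply hX (measurableSet_singleton x), smul_eq_mul, mul_comm]
  rfl

theorem measurePreserving_comp_of_injective {κ κ' E : Type*} [Fintype κ] [Fintype κ']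
    [MeasurableSpace E] (μ : Measure E) [IsProbabilityMeasure μ] {e : κ' → κ}
    (he : Function.Injective e) :
    MeasurePreserving (fun y : κ → E => y ∘ e) (Measure.pi fun _ => μ)
      (Measure.pi fun _ => μ) := by
  have hindep : iIndepFun (fun (j : κ') (y : κ → E) => y (e j)) (Measure.pi fun _ => μ) :=
    (iIndepFun_pi (X := fun _ => id) fun _ => aemeasurable_id).precomp he
  refine ⟨measurable_pi_lambda _ fun j => measurable_pi_apply (e j), ?_⟩
  change Measure.map (fun (y : κ → E) j => y (e j)) _ = _
  rw [hindep.map_fun_eq_pi_map fun j => (measurable_pi_apply (e j)).aemeasurable]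
  exact congrArg Measure.pi (funext fun j =>
    (measurePreserving_eval (fun _ : κ => μ) (e j)).map_eq)

variable {r s : ℕ} {p : ℝ}

theorem integral_comp_permOfPoints (hp : p ∈ Set.Icc (0 : ℝ) 1) (θ : Equiv.Perm (Fin r) → ℝ) :
    ∫ y, θ (permOfPoints y) ∂Measure.pi (fun _ : Fin r => pointLaw p) =
      ∑ π, θ π * patternMean p π := by
  have := isProbabilityMeasure_pointLaw hp
  exact integral_comp_eq_sum_measureReal measurable_permOfPoints θ

theorem psi_eq_measureReal_update (hp : p ∈ Set.Icc (0 : ℝ) 1) (a : Fin (s + 1))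
    (π : Equiv.Perm (Fin (s + 1))) (z : I × I) :
    psi p π z = (Measure.pi fun _ : Fin (s + 1) => pointLaw p).real
      {y | permOfPoints (Function.update y a z) = π} := by
  have := isProbabilityMeasure_pointLaw hp
  let extend (Z : Fin s → I × I) (i : Fin (s + 1)) : I × I :=
    if h : i.val < s then Z ⟨i.val, h⟩ else z
  let η : Equiv.Perm (Fin (s + 1)) := (finSuccEquiv' (Fin.last s)).trans (finSuccEquiv' a).symm
  have hextend : Measurable extend := by
    refine measurable_pi_lambda _ fun i => ?_
    by_cases h : i.val < s
    · simpa [extend, h] using measurable_pi_apply _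
    · simp [extend, h]
  have hrelabel (y : Fin (s + 1) → I × I) :
      Function.update y a z ∘ η = extend (y ∘ a.succAbove) := by
    ext1 i
    refine Fin.lastCases ?_ (fun j => ?_) i
    · have hη : η (Fin.last s) = a := by
        rw [Equiv.trans_apply, finSuccEquiv'_at, finSuccEquiv'_symm_none]
      simp [extend, hη]
    · have hη : η j.castSucc = a.succAbove j := by simp [η, ← Fin.succAbove_last]
      simp [extend, hη]
  have hset : MeasurableSet {Z | permOfPoints (extend Z) = π} :=
    (measurable_permOfPoints.comp hextend) (.of_discrete (s := {π}))
  refine Eq.trans (b := (Measure.pi fun _ : Fin s => pointLaw p).real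
    {Z | permOfPoints (extend Z) = π}) rfl ?_
  rw [← (measurePreserving_comp_of_injective (pointLaw p)
    a.succAbove_right_injective).measureReal_preimage hset.nullMeasurableSet]
  refine measureReal_congr ?_
  filter_upwards [ae_injective_fst_update hp a z] with y hy
  exact propext (by
    change permOfPoints (extend (y ∘ a.succAbove)) = π ↔ permOfPoints (Function.update y a z) = π
    rw [← hrelabel, permOfPoints_comp_perm hy])

theorem hoeffdingProj_comp_permOfPoints (hp : p ∈ Set.Icc (0 : ℝ) 1)
    (θ : Equiv.Perm (Fin (s + 1)) → ℝ) (a : Fin (s + 1)) (z : I × I) :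
    hoeffdingProj (fun _ => pointLaw p) (fun y => θ (permOfPoints y)) a z =
      ∑ π, θ π * psi p π z := by
  have := isProbabilityMeasure_pointLaw hp
  simp only [psi_eq_measureReal_update hp a]
  exact integral_comp_eq_sum_measureReal (measurable_permOfPoints.comp (by fun_prop)) θ

theorem measurable_psi (hp : p ∈ Set.Icc (0 : ℝ) 1) (π : Equiv.Perm (Fin (s + 1))) :
    Measurable (psi p π) := by
  classical
  have := isProbabilityMeasure_pointLaw hp
  have hindicator : psi p π = hoeffdingProj (fun _ => pointLaw p)
      (fun y => (Pi.single π 1 : Equiv.Perm (Fin (s + 1)) → ℝ) (permOfPoints y)) 0 := by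
    ext z
    rw [hoeffdingProj_comp_permOfPoints hp]
    simp [Pi.single_apply]
  rw [hindicator]
  exact measurable_hoeffdingProj _ (Measurable.of_discrete.comp measurable_permOfPoints) _

theorem abs_psi_le (hp : p ∈ Set.Icc (0 : ℝ) 1) (π : Equiv.Perm (Fin r)) (z : I × I) :
    |psi p π z| ≤ 1 := by
  have := isProbabilityMeasure_pointLaw hp
  rw [psi, abs_of_nonneg measureReal_nonneg]
  exact measureReal_le_one

/-- The function `(r - 1)!⁻¹ ∑ θ_π ψ_π`: the first order part of `patternStat p θ` is the normalized
sum of its values at the points `graphPoint`. -/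
noncomputable def projStat (p : ℝ) (θ : Equiv.Perm (Fin r) → ℝ) (z : I × I) : ℝ :=
  ∑ π, θ π / (r - 1)! * psi p π z

theorem hoeffdingProj_eq_factorial_mul_projStat (hp : p ∈ Set.Icc (0 : ℝ) 1)
    (θ : Equiv.Perm (Fin (s + 1)) → ℝ) (a : Fin (s + 1)) (z : I × I) :
    hoeffdingProj (fun _ => pointLaw p) (fun y => θ (permOfPoints y)) a z =
      s ! * projStat p θ z := by
  have hfac : (s ! : ℝ) ≠ 0 := Nat.cast_ne_zero.2 s.factorial_ne_zero
  rw [hoeffdingProj_comp_permOfPoints hp, projStat, Finset.mul_sum]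
  refine Finset.sum_congr rfl fun π _ => ?_
  rw [Nat.add_sub_cancel]
  field_simp

theorem measurable_projStat (hp : p ∈ Set.Icc (0 : ℝ) 1) (θ : Equiv.Perm (Fin (s + 1)) → ℝ) :
    Measurable (projStat p θ) :=
  Finset.measurable_fun_sum _ fun π _ => (measurable_psi hp π).const_mul _

theorem abs_projStat_le (hp : p ∈ Set.Icc (0 : ℝ) 1) (θ : Equiv.Perm (Fin r) → ℝ) (z : I × I) :
    |projStat p θ z| ≤ ∑ π, |θ π| := by
  refine (Finset.abs_sum_le_sum_abs _ _).trans (Finset.sum_le_sum fun π _ => ?_)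
  rw [abs_mul, abs_div, Nat.abs_cast]
  have hfac : (1 : ℝ) ≤ (r - 1)! := Nat.one_le_cast.2 (r - 1).factorial_pos
  exact (mul_le_of_le_one_right (by positivity) (abs_psi_le hp π z)).trans
    (div_le_self (abs_nonneg _) hfac)

open scoped Matrix in
theorem dotProduct_limitCov_mulVec (hp : p ∈ Set.Icc (0 : ℝ) 1) (q : ℝ)
    (θ : Equiv.Perm (Fin (s + 1)) → ℝ) :
    θ ⬝ᵥ (limitCov (s + 1) p q *ᵥ θ) = limitForm p q (projStat p θ) (projStat p θ) := by
  refine Eq.trans ?_ (limitForm_sum_mul p q (fun π => θ π / s !) (measurable_psi hp)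
    (abs_psi_le hp)).symm
  simp only [dotProduct, Matrix.mulVec, Finset.mul_sum, limitCov_apply, Nat.add_sub_cancel]
  exact Finset.sum_congr rfl fun π _ => Finset.sum_congr rfl fun π' _ => by ring

theorem isHermitian_limitCov (hp : p ∈ Set.Icc (0 : ℝ) 1) (q : ℝ) :
    (limitCov (s + 1) p q).IsHermitian := by
  refine Matrix.IsHermitian.ext fun π π' => ?_
  rw [star_trivial, limitCov_apply, limitCov_apply,
    limitForm_comm p q (measurable_psi hp π) (measurable_psi hp π')]

end PatternProjection

section ConjugationInvariance

theorem measurePreserving_uniformOn {Ω : Type*} [MeasurableSpace Ω] [MeasurableSingletonClass Ω]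
    {s : Set Ω} {f : Equiv.Perm Ω} (hf : Measurable f) (hs : f ⁻¹' s = s) :
    MeasurePreserving f (uniformOn s) (uniformOn s) := by
  refine ⟨hf, Measure.ext fun A hA => ?_⟩
  rw [Measure.map_apply hf hA, uniformOn, cond_apply' (hf hA), cond_apply' hA]
  congr 1
  nth_rewrite 1 [← hs]
  rw [← Set.preimage_inter, ← f.image_symm_eq_preimage,
    Measure.count_injective_image f.symm.injective]

variable {n : ℕ} {t : n.Partition}

theorem cyclicClass_nonempty (t : n.Partition) : (cyclicClass t).Nonempty := by
  have hsplit := Multiset.filter_add_not (2 ≤ ·) t.parts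
  have hones : t.parts.filter (¬ 2 ≤ ·) =
      .replicate (Multiset.card (t.parts.filter (¬ 2 ≤ ·))) 1 := by
    refine Multiset.eq_replicate_card.2 fun a ha => ?_
    have := t.parts_pos (Multiset.mem_filter.1 ha).1
    have := (Multiset.mem_filter.1 ha).2
    omega
  have hsum := congrArg Multiset.sum hsplit
  rw [Multiset.sum_add, t.parts_sum, hones, Multiset.sum_replicate, smul_eq_mul, mul_one] at hsum
  obtain ⟨g, hg⟩ : ∃ g : Equiv.Perm (Fin n), g.cycleType = t.parts.filter (2 ≤ ·) :=
    (Equiv.Perm.exists_with_cycleType_iff (Fin n)).2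
      ⟨by rw [Fintype.card_fin]; omega, fun a ha => (Multiset.mem_filter.1 ha).2⟩
  refine ⟨g, ?_⟩
  have hcard : Fintype.card (Fin n) - g.support.card =
      Multiset.card (t.parts.filter (¬ 2 ≤ ·)) := by
    rw [← Equiv.Perm.sum_cycleType, hg, Fintype.card_fin]
    omega
  rw [cyclicClass, Set.mem_ofPred_eq, Equiv.Perm.parts_partition, hg, hcard, ← hones, hsplit]

theorem integral_uniformOn_cyclicClass_conj (t : n.Partition) (H : Equiv.Perm (Fin n) → ℂ)
    (η : Equiv.Perm (Fin n)) :
    ∫ g, H (η * g * η⁻¹) ∂uniformOn (cyclicClass t) = ∫ g, H g ∂uniformOn (cyclicClass t) := by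
  have hconj := measurePreserving_uniformOn (s := cyclicClass t) (f := (MulAut.conj η).toEquiv)
    (measurable_of_finite _) (Set.ext fun _ => conj_mem_cyclicClass_iff η)
  exact hconj.integral_comp
    ⟨Equiv.injective _, measurable_of_finite _, fun _ _ => .of_discrete⟩ H

theorem norm_integral_uniformOn_cyclicClass_sub_le {H : Equiv.Perm (Fin n) → ℂ} {z : ℂ} {ε : ℝ}
    (hε : ∀ ρ ∈ cyclicClass t,
      ‖(∫ u : Fin n → I, H (standardize u * ρ * (standardize u)⁻¹)) - z‖ ≤ ε) :
    ‖(∫ g, H g ∂uniformOn (cyclicClass t)) - z‖ ≤ ε := by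
  have := isProbabilityMeasure_uniformOn (Set.toFinite _) (cyclicClass_nonempty t)
  let K (u : Fin n → I) (g : Equiv.Perm (Fin n)) : ℂ := H (standardize u * g * (standardize u)⁻¹)
  have hK : Measurable (Function.uncurry K) := by
    have hH : Measurable fun q : Equiv.Perm (Fin n) × Equiv.Perm (Fin n) => H (q.1 * q.2 * q.1⁻¹) :=
      measurable_of_finite _
    exact hH.comp (measurable_standardize.prodMap measurable_id)
  have hint : Integrable (Function.uncurry K) (volume.prod (uniformOn (cyclicClass t))) :=
    .of_bound hK.aestronglyMeasurable (∑ g, ‖H g‖) (ae_of_all _ fun _ =>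
      Finset.single_le_sum (f := fun g => ‖H g‖) (fun g _ => norm_nonneg _) (Finset.mem_univ _))
  have haverage : ∫ g, H g ∂uniformOn (cyclicClass t) =
      ∫ g, (∫ u, K u g) ∂uniformOn (cyclicClass t) := by
    rw [← integral_integral_swap hint]
    simp only [K, integral_uniformOn_cyclicClass_conj, integral_const, probReal_univ, one_smul]
  have hsub : (∫ g, H g ∂uniformOn (cyclicClass t)) - z =
      ∫ g, ((∫ u, K u g) - z) ∂uniformOn (cyclicClass t) := by
    rw [haverage, integral_sub .of_finite .of_finite, integral_const, probReal_univ, one_smul]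
  rw [hsub]
  refine (norm_integral_le_of_norm_le_const (ae_cond_of_forall_mem .of_discrete hε)).trans_eq ?_
  change ε * (uniformOn (cyclicClass t)).real _ = ε
  rw [probReal_univ, mul_one]

end ConjugationInvariance

section EmbeddingSums

theorem pow_succ_le_descFactorial_add (n s : ℕ) :
    n ^ (s + 1) ≤ n.descFactorial (s + 1) + (s + 1) ^ 2 * n ^ s := by
  induction s with
  | zero => simp
  | succ s ih =>
    have hle : n.descFactorial (s + 1) ≤ n ^ (s + 1) := n.descFactorial_le_pow _
    have hstep : n * n.descFactorial (s + 1) ≤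
        n.descFactorial (s + 2) + (s + 1) * n.descFactorial (s + 1) := by
      rw [n.descFactorial_succ (s + 1), ← add_mul]
      exact Nat.mul_le_mul_right _ (by omega)
    calc n ^ (s + 2) = n * n ^ (s + 1) := pow_succ' n (s + 1)
      _ ≤ n * (n.descFactorial (s + 1) + (s + 1) ^ 2 * n ^ s) := Nat.mul_le_mul_left _ ih
      _ = n * n.descFactorial (s + 1) + (s + 1) ^ 2 * n ^ (s + 1) := by ring
      _ ≤ n.descFactorial (s + 2) + (s + 1 + 1) ^ 2 * n ^ (s + 1) := by nlinarith

variable {ι κ : Type*} [Fintype ι] [Fintype κ] {F : (κ → ι) → ℝ} {C M : ℝ}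

theorem abs_sum_sub_sum_embedding_le [DecidableEq κ] (hF : ∀ k, |F k| ≤ C) :
    |∑ k, F k - ∑ k : κ ↪ ι, F k| ≤
      C * ((Fintype.card ι : ℝ) ^ Fintype.card κ -
        (Fintype.card ι).descFactorial (Fintype.card κ)) := by
  classical
  let S : Finset (κ → ι) := Finset.univ.map ⟨fun k : κ ↪ ι => k, DFunLike.coe_injective⟩
  have hsum : ∑ k : κ ↪ ι, F k = ∑ k ∈ S, F k := by simp [S]
  have hcard : (Sᶜ.card : ℝ) = (Fintype.card ι : ℝ) ^ Fintype.card κ -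
      (Fintype.card ι).descFactorial (Fintype.card κ) := by
    rw [Finset.card_compl, Finset.card_map, Finset.card_univ, Fintype.card_embedding_eq,
      Fintype.card_fun, Nat.cast_sub (Nat.descFactorial_le_pow _ _), Nat.cast_pow]
  rw [hsum, ← Finset.sum_add_sum_compl S, add_sub_cancel_left, ← hcard, mul_comm, ← nsmul_eq_mul]
  exact (Finset.abs_sum_le_sum_abs _ _).trans (Finset.sum_le_card_nsmul _ _ _ fun k _ => hF k)

theorem abs_sum_embedding_sub_le [DecidableEq κ] (hF : ∀ k, |F k| ≤ C) (hM : |M| ≤ C) :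
    |(∑ k : κ ↪ ι, F k - (Fintype.card ι).descFactorial (Fintype.card κ) * M) -
      (∑ k, F k - (Fintype.card ι : ℝ) ^ Fintype.card κ * M)| ≤
      2 * C * ((Fintype.card ι : ℝ) ^ Fintype.card κ -
        (Fintype.card ι).descFactorial (Fintype.card κ)) := by
  have h := abs_sum_sub_sum_embedding_le (F := fun k => F k - M) (C := 2 * C) fun k =>
    (abs_sub _ _).trans (by linarith [hF k])
  simp only [Finset.sum_sub_distrib, Finset.sum_const, Finset.card_univ, nsmul_eq_mul,
    Fintype.card_embedding_eq, Fintype.card_fun, Nat.cast_pow] at h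
  rwa [abs_sub_comm] at h

theorem abs_sum_embedding_graphPoint_sub_le [Nonempty ι] [DecidableEq ι] [DecidableEq κ]
    (ρ : Equiv.Perm ι) {p : ℝ} (hp : p ∈ Set.Icc (0 : ℝ) 1) {g : (κ → I × I) → ℝ}
    (hg : Measurable g) (hC : ∀ y, |g y| ≤ C) (u : ι → I) :
    |(∑ k : κ ↪ ι, g (fun a => graphPoint ρ u (k a)) -
        (Fintype.card ι).descFactorial (Fintype.card κ) *
          ∫ y, g y ∂Measure.pi (fun _ => pointLaw p)) -
      (Fintype.card ι : ℝ) ^ Fintype.card κ / Fintype.card ι *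
        ∑ a, ∑ i, centred ρ (hoeffdingProj (fun _ => pointLaw p) g a) i u| ≤
      |∑ k : κ → ι, graphRem ρ g k u| +
      2 * C * ((Fintype.card ι : ℝ) ^ Fintype.card κ -
        (Fintype.card ι).descFactorial (Fintype.card κ)) +
      (Fintype.card ι : ℝ) ^ Fintype.card κ * ((1 + 2 * Fintype.card κ) *
        (2 ^ Fintype.card κ * (Fintype.card κ * C)) * |fixFrac ρ - p|) := by
  have := isProbabilityMeasure_pointLaw hp
  have hembedding := abs_le.1 (abs_sum_embedding_sub_le
    (F := fun k : κ → ι => g fun a => graphPoint ρ u (k a)) (fun k => hC _)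
    (abs_integral_le_of_abs_le (μ := Measure.pi fun _ : κ => pointLaw p) hC))
  have hdecomposition := abs_le.1 (abs_sum_graphPoint_sub_le ρ hp hg hC u)
  have hrem := abs_le.1 (le_refl |∑ k : κ → ι, graphRem ρ g k u|)
  rw [abs_le]
  constructor <;> linarith

end EmbeddingSums

section PatternStatistic

variable {n r s : ℕ} {p : ℝ}

/-- The linear combination with coefficients `θ` of the normalized pattern counts of `τ`. -/
noncomputable def patternStat (p : ℝ) (θ : Equiv.Perm (Fin r) → ℝ) (τ : Equiv.Perm (Fin n)) : ℝ :=
  ∑ π, θ π * (((patternCount π τ : ℝ) - n.choose r * patternMean p π) /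
    (n : ℝ) ^ ((r : ℝ) - 1 / 2))

theorem patternStat_conj_standardize [NeZero n] (hp : p ∈ Set.Icc (0 : ℝ) 1)
    (θ : Equiv.Perm (Fin r) → ℝ) (ρ : Equiv.Perm (Fin n)) {u : Fin n → I}
    (hu : Function.Injective u) :
    patternStat p θ (standardize u * ρ * (standardize u)⁻¹) = √n / (r ! * n ^ r) *
      (∑ k : Fin r ↪ Fin n, θ (permOfPoints fun a => graphPoint ρ u (k a)) -
        n.descFactorial r * ∫ y, θ (permOfPoints y) ∂Measure.pi (fun _ : Fin r => pointLaw p)) := by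
  have hn : (0 : ℝ) < n := Nat.cast_pos.2 (NeZero.pos n)
  have hfac : (r ! : ℝ) ≠ 0 := Nat.cast_ne_zero.2 r.factorial_ne_zero
  have hpow : (n : ℝ) ^ ((r : ℝ) - 1 / 2) = n ^ r / √n := by
    rw [Real.rpow_sub hn, Real.rpow_natCast, Real.sqrt_eq_rpow]
  rw [sum_embedding_permOfPoints_graphPoint hu, integral_comp_permOfPoints hp,
    Nat.descFactorial_eq_factorial_mul_choose, patternStat, hpow]
  simp only [nsmul_eq_mul, Finset.mul_sum, ← Finset.sum_sub_distrib, Nat.cast_mul]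
  refine Finset.sum_congr rfl fun π _ => ?_
  field_simp

theorem measurable_comp_permOfPoints (θ : Equiv.Perm (Fin r) → ℝ) :
    Measurable fun y : Fin r → I × I => θ (permOfPoints y) :=
  (measurable_of_finite θ).comp measurable_permOfPoints

theorem abs_comp_permOfPoints_le (θ : Equiv.Perm (Fin r) → ℝ) (y : Fin r → I × I) :
    |θ (permOfPoints y)| ≤ ∑ π, |θ π| :=
  Finset.single_le_sum (f := fun π => |θ π|) (fun _ _ => abs_nonneg _) (Finset.mem_univ _)

theorem sum_centred_hoeffdingProj (hp : p ∈ Set.Icc (0 : ℝ) 1) (θ : Equiv.Perm (Fin (s + 1)) → ℝ)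
    (ρ : Equiv.Perm (Fin n)) (u : Fin n → I) :
    ∑ a, ∑ i, centred ρ
        (hoeffdingProj (fun _ => pointLaw p) (fun y => θ (permOfPoints y)) a) i u =
      (s + 1)! * ∑ i, centred ρ (projStat p θ) i u := by
  simp only [centred, hoeffdingProj_eq_factorial_mul_projStat hp, integral_const_mul, ← mul_sub,
    ← Finset.mul_sum]
  rw [Finset.sum_const, Finset.card_univ, Fintype.card_fin, nsmul_eq_mul,
    Nat.factorial_succ]
  push_cast
  ring

theorem abs_patternStat_sub_le [NeZero n] (hp : p ∈ Set.Icc (0 : ℝ) 1)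
    (θ : Equiv.Perm (Fin (s + 1)) → ℝ) (ρ : Equiv.Perm (Fin n)) {u : Fin n → I}
    (hu : Function.Injective u) :
    |patternStat p θ (standardize u * ρ * (standardize u)⁻¹) -
      (√n)⁻¹ * ∑ i, centred ρ (projStat p θ) i u| ≤
      √n / n ^ (s + 1) * |∑ k, graphRem ρ (fun y => θ (permOfPoints y)) k u| +
      2 * (∑ π, |θ π|) * (s + 1) ^ 2 * (√n)⁻¹ +
      (1 + 2 * (s + 1)) * (2 ^ (s + 1) * ((s + 1) * ∑ π, |θ π|)) * (√n * |fixFrac ρ - p|) := by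
  have hn : (0 : ℝ) < n := Nat.cast_pos.2 (NeZero.pos n)
  have hfac : (1 : ℝ) ≤ (s + 1)! := Nat.one_le_cast.2 (s + 1).factorial_pos
  set c := √n / ((s + 1)! * n ^ (s + 1)) with hc
  have hcle : c ≤ √n / n ^ (s + 1) := by
    rw [hc]
    gcongr
    exact le_mul_of_one_le_left (by positivity) hfac
  have hlinear : (√n)⁻¹ * ∑ i, centred ρ (projStat p θ) i u = c * (n ^ (s + 1) / n *
      ∑ a, ∑ i, centred ρ
        (hoeffdingProj (fun _ => pointLaw p) (fun y => θ (permOfPoints y)) a) i u) := by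
    rw [sum_centred_hoeffdingProj hp, hc]
    field_simp
    rw [Real.sq_sqrt hn.le, mul_comm]
  have hbound := abs_sum_embedding_graphPoint_sub_le ρ hp (measurable_comp_permOfPoints θ)
    (abs_comp_permOfPoints_le θ) u
  have hdesc : (n : ℝ) ^ (s + 1) - n.descFactorial (s + 1) ≤ (s + 1) ^ 2 * n ^ s :=
    sub_le_iff_le_add'.2 (by exact_mod_cast pow_succ_le_descFactorial_add n s)
  simp only [Fintype.card_fin, Nat.cast_add, Nat.cast_one] at hbound
  rw [patternStat_conj_standardize hp θ ρ hu, hlinear, ← mul_sub, abs_mul,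
    abs_of_nonneg (by positivity : 0 ≤ c)]
  refine (mul_le_mul hcle (hbound.trans (add_le_add_left (add_le_add_right
    (mul_le_mul_of_nonneg_left hdesc (by positivity)) _) _)) (abs_nonneg _)
    (by positivity)).trans_eq ?_
  field_simp
  rw [Real.sq_sqrt hn.le]
  ring

theorem norm_integral_cexp_sub_integral_cexp_le {Ω : Type*} [MeasurableSpace Ω] {μ : Measure Ω}
    [IsFiniteMeasure μ] {T S B : Ω → ℝ} (hT : Measurable T) (hS : Measurable S)
    (hB : Integrable B μ) (h : ∀ᵐ ω ∂μ, |T ω - S ω| ≤ B ω) :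
    ‖(∫ ω, Complex.exp (T ω * Complex.I) ∂μ) - ∫ ω, Complex.exp (S ω * Complex.I) ∂μ‖ ≤
      ∫ ω, B ω ∂μ := by
  have hint {F : Ω → ℝ} (hF : Measurable F) :
      Integrable (fun ω => Complex.exp (F ω * Complex.I)) μ :=
    .of_bound (by fun_prop : Measurable _).aestronglyMeasurable 1
      (ae_of_all _ fun ω => (Complex.norm_exp_ofReal_mul_I _).le)
  rw [← integral_sub (hint hT) (hint hS)]
  refine norm_integral_le_of_norm_le hB (h.mono fun ω hω => le_trans ?_ hω)
  have hfactor : Complex.exp (T ω * Complex.I) - Complex.exp (S ω * Complex.I) =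
      Complex.exp (S ω * Complex.I) * (Complex.exp (Complex.I * (T ω - S ω : ℝ)) - 1) := by
    rw [mul_sub, ← Complex.exp_add]
    push_cast
    ring_nf
  rw [hfactor, norm_mul, Complex.norm_exp_ofReal_mul_I, one_mul]
  exact Real.norm_exp_I_mul_ofReal_sub_one_le

section GraphRemainder

variable {ι κ : Type*} [Fintype ι] [DecidableEq ι] [Fintype κ] [DecidableEq κ]
  {g : (κ → I × I) → ℝ} {C : ℝ}

theorem abs_sum_graphRem_le (ρ : Equiv.Perm ι) (hC : ∀ y, |g y| ≤ C) (u : ι → I) :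
    |∑ k, graphRem ρ g k u| ≤ ∑ _k : κ → ι, 2 * (Fintype.card κ + 1) * C :=
  (Finset.abs_sum_le_sum_abs _ _).trans
    (Finset.sum_le_sum fun k _ => abs_hoeffdingRem_le (fun a => pairLaw ρ (k a)) hC _)

theorem integrable_sum_graphRem (ρ : Equiv.Perm ι) (hg : Measurable g) (hC : ∀ y, |g y| ≤ C) :
    Integrable fun u => ∑ k, graphRem ρ g k u :=
  integrable_of_abs_le (Finset.measurable_fun_sum _ fun k _ => measurable_graphRem ρ hg k)
    (abs_sum_graphRem_le ρ hC)

theorem integral_abs_sum_graphRem_le [Nonempty κ] (ρ : Equiv.Perm ι) (hg : Measurable g)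
    (hC : ∀ y, |g y| ≤ C) :
    ∫ u, |∑ k, graphRem ρ g k u| ≤
      24 * Fintype.card κ ^ 2 * (Fintype.card κ + 1) * C *
        (Fintype.card ι : ℝ) ^ (Fintype.card κ - 1) := by
  have hC0 : 0 ≤ C := (abs_nonneg _).trans (hC 0)
  refine (integral_abs_le_sqrt (Finset.measurable_fun_sum _ fun k _ => measurable_graphRem ρ hg k)
    (abs_sum_graphRem_le ρ hC) (integral_sum_graphRem_sq_le ρ hg hC)).trans_eq ?_
  rw [show 2 * Fintype.card κ - 2 = (Fintype.card κ - 1) * 2 by omega, pow_mul]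
  rw [Real.sqrt_eq_iff_mul_self_eq (by positivity) (by positivity)]
  ring

end GraphRemainder

theorem norm_integral_cexp_patternStat_sub_integral_cexp_le [NeZero n]
    (hp : p ∈ Set.Icc (0 : ℝ) 1) (θ : Equiv.Perm (Fin (s + 1)) → ℝ) (ρ : Equiv.Perm (Fin n)) :
    ‖(∫ u : Fin n → I, Complex.exp
        ((patternStat p θ (standardize u * ρ * (standardize u)⁻¹) : ℝ) * Complex.I)) -
      ∫ u, Complex.exp (((√n)⁻¹ * ∑ i, centred ρ (projStat p θ) i u : ℝ) * Complex.I)‖ ≤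
      (24 * (s + 2) + 2) * (s + 1) ^ 2 * (∑ π, |θ π|) * (√n)⁻¹ +
      (1 + 2 * (s + 1)) * (2 ^ (s + 1) * ((s + 1) * ∑ π, |θ π|)) * (√n * |fixFrac ρ - p|) := by
  have hn : (0 : ℝ) < n := Nat.cast_pos.2 (NeZero.pos n)
  have hT : Measurable fun u : Fin n → I =>
      patternStat p θ (standardize u * ρ * (standardize u)⁻¹) :=
    (measurable_of_finite fun η : Equiv.Perm (Fin n) => patternStat p θ (η * ρ * η⁻¹)).comp
      measurable_standardize
  have hS : Measurable fun u => (√n)⁻¹ * ∑ i, centred ρ (projStat p θ) i u :=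
    (Finset.measurable_fun_sum _ fun i _ =>
      measurable_centred (measurable_projStat hp θ) i).const_mul _
  have hR := (integrable_sum_graphRem ρ (measurable_comp_permOfPoints θ)
    (abs_comp_permOfPoints_le θ)).abs.const_mul (√n / n ^ (s + 1))
  have hRle : ∫ u, |∑ k, graphRem ρ (fun y => θ (permOfPoints y)) k u| ≤
      24 * (s + 1) ^ 2 * (s + 1 + 1) * (∑ π, |θ π|) * n ^ s := by
    simpa using integral_abs_sum_graphRem_le ρ (measurable_comp_permOfPoints θ)
      (abs_comp_permOfPoints_le θ)
  refine (norm_integral_cexp_sub_integral_cexp_le hT hS (hR.add (integrable_const _))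
    (ae_injective_pi.mono fun u hu =>
      (abs_patternStat_sub_le hp θ ρ hu).trans_eq (add_assoc _ _ _))).trans ?_
  rw [integral_add' hR (integrable_const _), integral_const_mul, integral_const, probReal_univ,
    one_smul, ← add_assoc]
  refine add_le_add_left ((add_le_add_left (mul_le_mul_of_nonneg_left hRle (by positivity))
    _).trans_eq ?_) _
  field_simp
  rw [Real.sq_sqrt hn.le]
  ring

theorem exists_norm_integral_cexp_patternStat_sub_le (hp : p ∈ Set.Icc (0 : ℝ) 1)
    (θ : Equiv.Perm (Fin (s + 1)) → ℝ) :
    ∃ K, ∀ (n : ℕ) [NeZero n] (ρ : Equiv.Perm (Fin n)),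
      ‖(∫ u : Fin n → I, Complex.exp
          ((patternStat p θ (standardize u * ρ * (standardize u)⁻¹) : ℝ) * Complex.I)) -
        Complex.exp (-(linearVariance ρ (projStat p θ) / 2 : ℝ))‖ ≤
        K * ((√n)⁻¹ + √n * |fixFrac ρ - p|) := by
  let K₁ : ℝ := (24 * (s + 2) + 2) * (s + 1) ^ 2 * ∑ π, |θ π|
  let K₂ : ℝ := (1 + 2 * (s + 1)) * (2 ^ (s + 1) * ((s + 1) * ∑ π, |θ π|))
  let K₃ : ℝ := 24 * √27 * (∑ π, |θ π|) ^ 2 + 216 * (∑ π, |θ π|) ^ 3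
  refine ⟨K₁ + K₂ + K₃, fun n _ ρ => ?_⟩
  have hlinear : _ ≤ K₁ * _ + K₂ * _ := norm_integral_cexp_patternStat_sub_integral_cexp_le hp θ ρ
  have hgaussian : _ ≤ K₃ * _ := norm_integral_cexp_centred_sub_le (ρ := ρ)
    (measurable_projStat hp θ) (abs_projStat_le hp θ)
  rw [Fintype.card_fin] at hgaussian
  have hK : 0 ≤ K₂ * (√n)⁻¹ + (K₁ + K₃) * (√n * |fixFrac ρ - p|) := by positivity
  refine (norm_sub_le_norm_sub_add_norm_sub _ _ _).trans
    ((add_le_add hlinear hgaussian).trans ?_)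
  linarith

end PatternStatistic

section Frequencies

variable {a : ℕ → ℝ} {c : ℝ}

theorem isBigO_sqrt_natCast :
    (fun n : ℕ => √(n : ℝ)) =O[atTop] fun n : ℕ => (n : ℝ) := by
  refine .of_bound' ?_
  filter_upwards [eventually_ge_atTop 1] with n hn
  rw [Real.norm_of_nonneg (Real.sqrt_nonneg _), Real.norm_of_nonneg n.cast_nonneg]
  have hn1 : (1 : ℝ) ≤ n := Nat.one_le_cast.2 hn
  exact Real.sqrt_le_self_iff.2 (.inr hn1)

theorem tendsto_div_natCast (h : (fun n : ℕ => a n - n * c) =o[atTop] fun n : ℕ => (n : ℝ)) :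
    Tendsto (fun n : ℕ => a n / n) atTop (nhds c) := by
  have hlim := h.tendsto_div_nhds_zero.add_const c
  rw [zero_add] at hlim
  refine hlim.congr' ?_
  filter_upwards [eventually_ne_atTop 0] with n hn
  field_simp
  ring

theorem tendsto_sqrt_mul_abs_div_natCast_sub
    (h : (fun n : ℕ => a n - n * c) =o[atTop] fun n : ℕ => √(n : ℝ)) :
    Tendsto (fun n : ℕ => √(n : ℝ) * |a n / n - c|) atTop (nhds 0) := by
  have hlim := h.tendsto_div_nhds_zero.abs
  rw [abs_zero] at hlim
  refine hlim.congr' ?_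
  filter_upwards [eventually_gt_atTop 0] with n hn
  have hn0 : (0 : ℝ) < n := Nat.cast_pos.2 hn
  rw [abs_div, abs_of_nonneg (Real.sqrt_nonneg _), div_eq_iff (Real.sqrt_pos.2 hn0).ne',
    mul_right_comm, Real.mul_self_sqrt hn0.le]
  nth_rw 2 [← abs_of_pos hn0]
  rw [← abs_mul, mul_sub, mul_div_cancel₀ _ hn0.ne']

end Frequencies

section Limit

variable {p : ℝ} {n r s : ℕ}

theorem linearVariance_of_mem_cyclicClass [NeZero n] {t : n.Partition} {ρ : Equiv.Perm (Fin n)}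
    (hρ : ρ ∈ cyclicClass t) {f : I × I → ℝ} {C : ℝ} (hf : Measurable f) (hC : ∀ z, |f z| ≤ C) :
    linearVariance ρ f = limitForm (numCycles t 1 / n) (2 * numCycles t 2 / n) f f := by
  rw [linearVariance_eq_limitForm hf hC, fixFrac, twoCycleFrac,
    card_fixedPoints_of_mem_cyclicClass hρ, card_twoCyclePoints_of_mem_cyclicClass hρ,
    Fintype.card_fin, Nat.cast_mul, Nat.cast_two]

theorem limitForm_numCycles_nonneg [NeZero n] (t : n.Partition) {f : I × I → ℝ} {C : ℝ}
    (hf : Measurable f) (hC : ∀ z, |f z| ≤ C) :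
    0 ≤ limitForm (numCycles t 1 / n) (2 * numCycles t 2 / n) f f := by
  obtain ⟨ρ, hρ⟩ := cyclicClass_nonempty t
  rw [← linearVariance_of_mem_cyclicClass hρ hf hC]
  exact linearVariance_nonneg

theorem exists_norm_integral_uniformOn_cexp_patternStat_sub_le (hp : p ∈ Set.Icc (0 : ℝ) 1)
    (θ : Equiv.Perm (Fin (s + 1)) → ℝ) :
    ∃ K, ∀ (n : ℕ) [NeZero n] (t : n.Partition),
      ‖(∫ g, Complex.exp ((patternStat p θ g : ℝ) * Complex.I) ∂uniformOn (cyclicClass t)) -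
        Complex.exp (-(limitForm (numCycles t 1 / n) (2 * numCycles t 2 / n)
          (projStat p θ) (projStat p θ) / 2 : ℝ))‖ ≤
        K * ((√n)⁻¹ + √n * |numCycles t 1 / n - p|) := by
  obtain ⟨K, hK⟩ := exists_norm_integral_cexp_patternStat_sub_le hp θ
  refine ⟨K, fun n _ t => norm_integral_uniformOn_cyclicClass_sub_le fun ρ hρ => ?_⟩
  have h := hK n ρ
  rwa [linearVariance_of_mem_cyclicClass hρ (measurable_projStat hp θ) (abs_projStat_le hp θ),
    fixFrac, card_fixedPoints_of_mem_cyclicClass hρ, Fintype.card_fin] at h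

/-- The vector of normalized pattern counts of `τ`, centred by their asymptotic means. -/
noncomputable def normalizedCounts (r : ℕ) (p : ℝ) (τ : Equiv.Perm (Fin n)) :
    EuclideanSpace ℝ (Equiv.Perm (Fin r)) :=
  WithLp.toLp 2 fun π => ((patternCount π τ : ℝ) - n.choose r * patternMean p π) /
    (n : ℝ) ^ ((r : ℝ) - 1 / 2)

theorem inner_normalizedCounts (τ : Equiv.Perm (Fin n))
    (θ : EuclideanSpace ℝ (Equiv.Perm (Fin r))) :
    inner ℝ (normalizedCounts r p τ) θ = patternStat p θ.ofLp τ := by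
  rw [PiLp.inner_apply]
  rfl

theorem charFun_map_normalizedCounts {Ω : Type*} [MeasurableSpace Ω] {P : Measure Ω}
    {ν : Measure (Equiv.Perm (Fin n))} {τ : Ω → Equiv.Perm (Fin n)} (hτ : HasLaw τ ν P)
    (θ : EuclideanSpace ℝ (Equiv.Perm (Fin r))) :
    charFun (P.map fun ω => normalizedCounts r p (τ ω)) θ =
      ∫ g, Complex.exp ((patternStat p θ.ofLp g : ℝ) * Complex.I) ∂ν := by
  have hmeas : Measurable (normalizedCounts (n := n) r p) := measurable_of_finite _
  have hmap : P.map (fun ω => normalizedCounts r p (τ ω)) = ν.map (normalizedCounts r p) := by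
    rw [← hτ.map_eq, AEMeasurable.map_map_of_aemeasurable hmeas.aemeasurable hτ.aemeasurable]
    rfl
  rw [hmap, charFun_apply, integral_map hmeas.aemeasurable (by fun_prop)]
  simp only [inner_normalizedCounts]

variable {t : (n : ℕ) → n.Partition} {p₁ p₂ : ℝ}

open scoped Matrix in
theorem tendsto_limitForm_numCycles (hp₁ : p₁ ∈ Set.Icc (0 : ℝ) 1)
    (ht₁ : (fun n : ℕ => (numCycles (t n) 1 : ℝ) - n * p₁) =o[atTop] fun n : ℕ => (n : ℝ))
    (ht₂ : (fun n : ℕ => 2 * (numCycles (t n) 2 : ℝ) - n * p₂) =o[atTop] fun n : ℕ => (n : ℝ))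
    (θ : Equiv.Perm (Fin (s + 1)) → ℝ) :
    Tendsto (fun n : ℕ => limitForm (numCycles (t n) 1 / n) (2 * numCycles (t n) 2 / n)
        (projStat p₁ θ) (projStat p₁ θ)) atTop
      (nhds (θ ⬝ᵥ (limitCov (s + 1) p₁ p₂ *ᵥ θ))) := by
  rw [dotProduct_limitCov_mulVec hp₁]
  exact ((continuous_limitForm _ _).tendsto (p₁, p₂)).comp
    ((tendsto_div_natCast ht₁).prodMk_nhds (tendsto_div_natCast ht₂))

theorem posSemidef_limitCov (hp₁ : p₁ ∈ Set.Icc (0 : ℝ) 1)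
    (ht₁ : (fun n : ℕ => (numCycles (t n) 1 : ℝ) - n * p₁) =o[atTop] fun n : ℕ => (n : ℝ))
    (ht₂ : (fun n : ℕ => 2 * (numCycles (t n) 2 : ℝ) - n * p₂) =o[atTop] fun n : ℕ => (n : ℝ)) :
    (limitCov (s + 1) p₁ p₂).PosSemidef := by
  refine .of_dotProduct_mulVec_nonneg (isHermitian_limitCov hp₁ p₂) fun θ => ?_
  rw [star_trivial]
  refine ge_of_tendsto (tendsto_limitForm_numCycles hp₁ ht₁ ht₂ θ) ?_
  filter_upwards [eventually_ne_atTop 0] with n hn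
  have : NeZero n := ⟨hn⟩
  exact limitForm_numCycles_nonneg _ (measurable_projStat hp₁ θ) (abs_projStat_le hp₁ θ)

open scoped Matrix in
theorem tendsto_integral_uniformOn_cexp_patternStat (hp₁ : p₁ ∈ Set.Icc (0 : ℝ) 1)
    (ht₁ : (fun n : ℕ => (numCycles (t n) 1 : ℝ) - n * p₁) =o[atTop] fun n : ℕ => √(n : ℝ))
    (ht₂ : (fun n : ℕ => 2 * (numCycles (t n) 2 : ℝ) - n * p₂) =o[atTop] fun n : ℕ => (n : ℝ))
    (θ : Equiv.Perm (Fin (s + 1)) → ℝ) :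
    Tendsto (fun n => ∫ g, Complex.exp ((patternStat p₁ θ g : ℝ) * Complex.I)
        ∂uniformOn (cyclicClass (t n))) atTop
      (nhds (Complex.exp (-(θ ⬝ᵥ (limitCov (s + 1) p₁ p₂ *ᵥ θ) / 2 : ℝ)))) := by
  obtain ⟨K, hK⟩ := exists_norm_integral_uniformOn_cexp_patternStat_sub_le hp₁ θ
  have hvariance := tendsto_limitForm_numCycles hp₁ (ht₁.trans_isBigO isBigO_sqrt_natCast) ht₂ θ
  have hgaussian := (show Continuous fun v : ℝ => Complex.exp (-(v / 2 : ℝ)) by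
    fun_prop).continuousAt.tendsto.comp hvariance
  have herror : Tendsto (fun n : ℕ => K * ((√(n : ℝ))⁻¹ + √n * |numCycles (t n) 1 / n - p₁|))
      atTop (nhds 0) := by
    have hsqrt : Tendsto (fun n : ℕ => (√(n : ℝ))⁻¹) atTop (nhds 0) :=
      (Real.tendsto_sqrt_atTop.comp tendsto_natCast_atTop_atTop).inv_tendsto_atTop
    simpa only [add_zero, mul_zero] using
      (hsqrt.add (tendsto_sqrt_mul_abs_div_natCast_sub ht₁)).const_mul K
  refine tendsto_of_tendsto_of_dist hgaussian (squeeze_zero' (.of_forall fun _ => dist_nonneg) ?_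
    herror)
  filter_upwards [eventually_ne_atTop 0] with n hn
  have : NeZero n := ⟨hn⟩
  rw [dist_comm, dist_eq_norm]
  exact hK n (t n)

end Limit

end PermPattern

theorem mainTheorem8
    (t : (n : ℕ) → n.Partition) (p₁ p₂ : ℝ)
    (hp₁ : p₁ ∈ Set.Icc (0 : ℝ) 1) (hp₂ : p₂ ∈ Set.Icc (0 : ℝ) 1)
    (ht₁ : (fun n : ℕ => (PermPattern.numCycles (t n) 1 : ℝ) - n * p₁)
      =o[atTop] (fun n : ℕ => Real.sqrt n))
    (ht₂ : (fun n : ℕ => 2 * (PermPattern.numCycles (t n) 2 : ℝ) - n * p₂)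
      =o[atTop] (fun n : ℕ => (n : ℝ)))
    {Ω : ℕ → Type*} [mΩ : ∀ n, MeasurableSpace (Ω n)]
    (P : (n : ℕ) → Measure (Ω n)) [hP : ∀ n, IsProbabilityMeasure (P n)]
    (τ : (n : ℕ) → Ω n → Equiv.Perm (Fin n))
    (hτ : ∀ n, HasLaw (τ n) (uniformOn (PermPattern.cyclicClass (t n))) (P n))
    (r : ℕ) (hr : 1 ≤ r) :
    (PermPattern.limitCov r p₁ p₂).PosSemidef ∧
    TendstoInDistribution
      (fun (n : ℕ) (ω : Ω n) =>
        (WithLp.toLp 2 fun π : Equiv.Perm (Fin r) =>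
          ((PermPattern.patternCount π (τ n ω) : ℝ)
              - (n.choose r : ℝ) * PermPattern.patternMean p₁ π)
            / (n : ℝ) ^ ((r : ℝ) - 1 / 2) : EuclideanSpace ℝ (Equiv.Perm (Fin r))))
      atTop
      (id : EuclideanSpace ℝ (Equiv.Perm (Fin r)) → EuclideanSpace ℝ (Equiv.Perm (Fin r)))
      P
      (multivariateGaussian 0 (PermPattern.limitCov r p₁ p₂)) := by
  obtain ⟨s, rfl⟩ : ∃ s, r = s + 1 := Nat.exists_eq_add_of_le' hr
  have hpsd : (PermPattern.limitCov (s + 1) p₁ p₂).PosSemidef :=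
    PermPattern.posSemidef_limitCov hp₁ (ht₁.trans_isBigO PermPattern.isBigO_sqrt_natCast) ht₂
  have hmeas (n : ℕ) : Measurable (PermPattern.normalizedCounts (n := n) (s + 1) p₁) :=
    measurable_of_finite _
  refine ⟨hpsd, fun n => (hmeas n).comp_aemeasurable (hτ n).aemeasurable, aemeasurable_id,
    ProbabilityMeasure.tendsto_iff_tendsto_charFun.2 fun θ => ?_⟩
  change Tendsto (fun n => charFun
    ((P n).map fun ω => PermPattern.normalizedCounts (s + 1) p₁ (τ n ω)) θ) atTop
    (nhds (charFun ((multivariateGaussian 0 (PermPattern.limitCov (s + 1) p₁ p₂)).map id) θ))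
  simp only [PermPattern.charFun_map_normalizedCounts (hτ _)]
  rw [Measure.map_id, charFun_multivariateGaussian hpsd, inner_zero_right, Complex.ofReal_zero,
    zero_mul, zero_sub]
  simpa only [Complex.ofReal_neg, Complex.ofReal_div, Complex.ofReal_ofNat] using
    PermPattern.tendsto_integral_uniformOn_cexp_patternStat hp₁ ht₁ ht₂ θ.ofLp
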